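/- Let $X$ be a (real or complex) Banach space with an unconditional basis $(e_i)_{i\in\mathbb N}$. A \emph{block-basis} of a sequence $(u_i)_{i\in\mathbb N}$ in $X$ is a sequence of nonzero finite linear combinations of the $u_i$ with successive supports. A \emph{block-subspace} of $X$ is the closed linear span $[y]$ of a block-basis $y$ of $(e_i)$; it is considered with its natural basis $y$, and its own block-subspaces are the closed spans of block-bases of $y$. Write $\simeq$ for linear homeomorphism of Banach spaces. For $Y=[y]$, where $y$ is a block-basis of $(e_i)$ (including $y=(e_i)$, $Y=X$), let $\mathbf Q_Y$ be the countable set of vectors $v/\|v\|$, where $v$ is a nonzero finite linear combination of the $y_i$ with coefficients in $\mathbb Q$ (in $\mathbb Q+i\mathbb Q$ in the complex case), and let $bb_d(Y)$ be the set of block-bases of $y$ consisting of vectors of $\mathbf Q_Y$, with the topology induced by the product of the discrete topologies on $\mathbf Q_Y$. The isomorphism class in $bb_d(Y)$ of $a\in bb_d(Y)$ is $\{b\in bb_d(Y): [b]\simeq[a]\}$; a \emph{residual class} in $bb_d(Y)$ is such a class that is residual (comeagre) in $bb_d(Y)$. $X$ is \emph{ergodic} if there is a Borel map $f$ from $\{0,1\}^{\mathbb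 N}$ to the set of closed linear subspaces of $X$, equipped with the Effros-Borel structure, such that for all $\alpha,\beta$: $\alpha$ and $\beta$ agree from some index on if and only if $f(\alpha)\simeq f(\beta)$. A block-subspace $Y$ of $X$ is \emph{block-minimal} if every block-subspace of $Y$ has a further block-subspace isomorphic to $Y$; $X$ is \emph{hereditarily block-minimal} if all its block-subspaces are block-minimal. Suppose that $X$ is not ergodic. Then for every block-subspace $Y$ of $X$ (in particular for $Y=X$) there is a residual class in $bb_d(Y)$. If $a\in bb_d(X)$ belongs to the residual class in $bb_d(X)$ and $A=[a]$, then $A\simeq A\oplus Y$ for every block-subspace $Y$ of $X$. If moreover $X$ is hereditarily block-minimal, then all residual classes in $bb_d(Y)$, for block-subspaces $Y$ of $X$, are isomorphic: whenever $Y,Z$ are block-subspaces of $X$, $a$ belongs to a residual class in $bb_d(Y)$ and $b$ to a residual class in $bb_d(Z)$, then $[a]\simeq[b]$. -/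

import Mathlib

open Set Topology

namespace ErgodicBanach

section

variable (𝕜 : Type*) {X : Type*} [RCLike 𝕜] [NormedAddCommGroup X] [NormedSpace 𝕜 X]

/-- `E₀`: eventual agreement of infinite binary sequences. -/
def E₀ (α β : ℕ → Bool) : Prop := ∃ n, ∀ m, n ≤ m → α m = β m

variable (X) in
/-- The Effros-Borel structure on the set of closed linear subspaces of `X`, generated by the sets
`{F | F ∩ U ≠ ∅}` with `U` open. -/
abbrev effrosBorel : MeasurableSpace (ClosedSubmodule 𝕜 X) :=
  MeasurableSpace.generateFrom
    {S | ∃ U : Set X, IsOpen U ∧ S = {F : ClosedSubmodule 𝕜 X | ((F : Set X) ∩ U).Nonempty}}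

variable (X) in
/-- `X` is ergodic: `E₀` Borel reduces to (linear homeomorphic) isomorphism between closed linear
subspaces of `X`. -/
def IsErgodicSpace : Prop :=
  ∃ f : (ℕ → Bool) → ClosedSubmodule 𝕜 X,
    @Measurable _ _ (borel (ℕ → Bool)) (effrosBorel 𝕜 X) f ∧
      ∀ α β, E₀ α β ↔ Nonempty ((f α).toSubmodule ≃L[𝕜] (f β).toSubmodule)

/-- `[y]`: the closed linear span of a sequence. -/
def closedSpan (y : ℕ → X) : Submodule 𝕜 X := (Submodule.span 𝕜 (range y)).topologicalClosure

/-- `y` is a block-basis of `e`: a sequence of nonzero finitely supported vectors with successive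
supports, i.e. each `y n` is a combination of the `e i` with `i` in the `n`-th of a sequence of
successive intervals. Used both for the basis `e` of `X` and for the natural basis `e` of a
block-subspace `[e]`. The vectors need not be normalized. -/
def IsBlockBasis (e y : ℕ → X) : Prop :=
  (∀ n, y n ≠ 0) ∧
    ∃ p : ℕ → ℕ, StrictMono p ∧
      ∀ n, y n ∈ Submodule.span 𝕜 (e '' Set.Ico (p n) (p (n + 1)))

/-- The space `[e]` with basis `e` is block-minimal: every block-subspace has a further
block-subspace isomorphic to `[e]`. -/
def BlockMinimal (e : ℕ → X) : Prop :=
  ∀ y, IsBlockBasis 𝕜 e y →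
    ∃ z, IsBlockBasis 𝕜 y z ∧ Nonempty (closedSpan 𝕜 z ≃L[𝕜] closedSpan 𝕜 e)

/-- Every block-subspace of `[e]` is block-minimal. -/
def HereditarilyBlockMinimal (e : ℕ → X) : Prop :=
  ∀ y, IsBlockBasis 𝕜 e y → BlockMinimal 𝕜 y

variable {𝕜} in
/-- Elements of `ℚ` if `𝕜 = ℝ` (where `RCLike.I = 0`), and of `ℚ + iℚ` if `𝕜 = ℂ`. -/
def IsRationalScalar (c : 𝕜) : Prop := ∃ q r : ℚ, c = (q : 𝕜) + (r : 𝕜) * RCLike.I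

/-- The countable set **Q** of normalizations `v / ‖v‖` of the nonzero finite combinations `v`
of the `e i` with rational coordinates. -/
structure RatBlock (e : ℕ → X) where
  /-- The underlying vector. -/
  val : X
  rational : ∃ c : ℕ →₀ 𝕜, (∀ i, IsRationalScalar (c i)) ∧
    Finsupp.linearCombination 𝕜 e c ≠ 0 ∧
    val = ((‖Finsupp.linearCombination 𝕜 e c‖⁻¹ : ℝ) : 𝕜) • Finsupp.linearCombination 𝕜 e c

/-- **Q** carries the discrete topology. -/
instance (e : ℕ → X) : TopologicalSpace (RatBlock 𝕜 e) := ⊥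

/-- `bb_d([e])`: the block-bases of `e` consisting of vectors of **Q**. Its topology is the
subspace topology of the product of the discrete topologies. -/
abbrev BBd (e : ℕ → X) : Type _ :=
  {x : ℕ → RatBlock 𝕜 e // IsBlockBasis 𝕜 e fun n => (x n).val}

variable {𝕜} in
/-- The block-subspace `[x]` spanned by `x ∈ bb_d([e])`. -/
def BBd.space {e : ℕ → X} (x : BBd 𝕜 e) : Submodule 𝕜 X := closedSpan 𝕜 fun n => (x.1 n).val

variable {𝕜} in
/-- The isomorphism class of `a` in `bb_d([e])` is residual (comeagre). -/
def InResidualClass {e : ℕ → X} (a : BBd 𝕜 e) : Prop :=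
  {b : BBd 𝕜 e | Nonempty (a.space ≃L[𝕜] b.space)} ∈ residual (BBd 𝕜 e)

end

end ErgodicBanach

/-! An element of `bb_d(Y)` is treated as a sequence over a countable set whose terms carry support
intervals. Such sequences form a Polish space. Isomorphism of closed spans is an analytic
equivalence relation on it, and it contains eventual equality, because changing finitely many terms
only exchanges summands of the same finite dimension.

Existence. If the relation is meagre, a binary tree grown inside dense open sets that avoid it
reduces `E₀` continuously to it (`exists_continuous_reduction`). Closed spans depend on the sequence
in a Borel way, so `X` would be ergodic. Otherwise analyticity makes the relation comeagre in some
nonempty open set; a Kuratowski–Ulam argument then gives a class comeagre in an open set, and a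
zero-one law (`mem_residual_of_isMeagre_cyl_diff`) makes that class residual.

Absorption. Let `A` be generic and let `W` be a block-subspace, spanned after a small perturbation
by a rational block basis `v`. The indices of `v` split into `J` and `J'` in such a way that, for
each half, some generic sequence stays generic when the corresponding terms of `v` are inserted into
it (`exists_generic_interleaved`). Unconditionality turns the insertion into a direct sum, so `A ≃ A
⊕ [v_J]` and `A ≃ A ⊕ [v_J']`, hence `A ≃ A ⊕ W`.

Uniqueness. Under hereditary block-minimality a gliding hump shows that every block-subspace is
isomorphic to a block-subspace of any other (`HereditarilyBlockMinimal.exists_equiv_block`). Two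
generic spaces thus absorb each other: `A ≃ A ⊕ B ≃ B`. -/

namespace ErgodicBanach

/-! ### Baire category: analytic sets and sections of meagre sets. -/

section Category

variable {Z : Type*} [TopologicalSpace Z]

/-- The set of points near which `A` is everywhere nonmeagre. -/
def categoryClosure (A : Set Z) : Set Z :=
  {x | ∀ U : Set Z, IsOpen U → x ∈ U → ¬ IsMeagre (U ∩ A)}

theorem isClosed_categoryClosure (A : Set Z) : IsClosed (categoryClosure A) := by
  rw [← isOpen_compl_iff, isOpen_iff_forall_mem_open]
  intro x hx
  simp only [categoryClosure, mem_compl_iff, mem_ofPred_eq, not_forall, not_not] at hx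
  obtain ⟨U, hU, hxU, hm⟩ := hx
  exact ⟨U, fun y hy hyc => hyc U hU hy hm, hU, hxU⟩

theorem categoryClosure_subset_closure (A : Set Z) : categoryClosure A ⊆ closure A := by
  intro x hx
  rw [mem_closure_iff]
  intro U hU hxU
  exact nonempty_of_not_isMeagre (hx U hU hxU)

theorem isMeagre_diff_categoryClosure [SecondCountableTopology Z] (A : Set Z) :
    IsMeagre (A \ categoryClosure A) := by
  have h : IsMeagre (⋃ B ∈ {B ∈ TopologicalSpace.countableBasis Z | IsMeagre (B ∩ A)}, B ∩ A) :=
    isMeagre_biUnion ((TopologicalSpace.countable_countableBasis Z).mono (sep_subset _ _))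
      fun B hB => hB.2
  refine h.mono ?_
  rintro x ⟨hxA, hx⟩
  simp only [categoryClosure, mem_ofPred_eq, not_forall, not_not] at hx
  obtain ⟨U, hU, hxU, hm⟩ := hx
  obtain ⟨B, hB, hxB, hBU⟩ :=
    (TopologicalSpace.isBasis_countableBasis Z).exists_subset_of_mem_open hxU hU
  exact mem_biUnion (x := B) ⟨hB, hm.mono (inter_subset_inter_left _ hBU)⟩ ⟨hxB, hxA⟩

theorem isMeagre_closed_diff_interior {F : Set Z} (hF : IsClosed F) :
    IsMeagre (F \ interior F) := by
  have h : IsNowhereDense (frontier F) :=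
    isClosed_frontier.isNowhereDense_iff.2 (interior_frontier hF)
  rw [hF.frontier_eq] at h
  exact h.isMeagre

/-- Off the closure of the union of the interiors of the `categoryClosure (A n)`, every `A n` is
meagre, so the union of the `A n` is nowhere nonmeagre there. Only boundaries of open and closed
sets remain, and these are nowhere dense. -/
theorem isMeagre_categoryClosure_diff_iUnion [SecondCountableTopology Z] (A : ℕ → Set Z) :
    IsMeagre (categoryClosure (⋃ n, A n) \ ⋃ n, categoryClosure (A n)) := by
  set O := interior (categoryClosure (⋃ n, A n)) with hO
  set G := ⋃ n, interior (categoryClosure (A n)) with hG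
  have hGo : IsOpen G := isOpen_iUnion fun n => isOpen_interior
  have hV : O \ closure G = ∅ := by
    by_contra hne
    obtain ⟨x, hxO, hxG⟩ := nonempty_iff_ne_empty.2 hne
    refine interior_subset hxO (O \ closure G)
      (isOpen_interior.sdiff isClosed_closure) ⟨hxO, hxG⟩ ?_
    have hm : IsMeagre (⋃ n, (A n \ categoryClosure (A n)) ∪
        (categoryClosure (A n) \ interior (categoryClosure (A n)))) :=
      isMeagre_iUnion fun n => (isMeagre_diff_categoryClosure _).union
        (isMeagre_closed_diff_interior (isClosed_categoryClosure _))
    refine hm.mono ?_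
    rintro y ⟨⟨-, hyG⟩, hyA⟩
    obtain ⟨n, hn⟩ := mem_iUnion.1 hyA
    refine mem_iUnion.2 ⟨n, ?_⟩
    by_cases hc : y ∈ categoryClosure (A n)
    · exact Or.inr ⟨hc, fun hi => hyG (subset_closure (mem_iUnion.2 ⟨n, hi⟩))⟩
    · exact Or.inl ⟨hn, hc⟩
  have h1 : IsMeagre (closure G \ G) := by
    have h : IsNowhereDense (frontier G) := isClosed_frontier.isNowhereDense_iff.2 (by
      rw [← frontier_compl]
      exact interior_frontier hGo.isClosed_compl)
    rw [hGo.frontier_eq] at h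
    exact h.isMeagre
  refine ((isMeagre_closed_diff_interior (isClosed_categoryClosure (⋃ n, A n))).union h1).mono ?_
  rintro x ⟨hx, hxn⟩
  have hxG : x ∉ G := fun h => hxn (iUnion_mono (fun n => interior_subset) h)
  by_cases hxO : x ∈ O
  · right
    refine ⟨?_, hxG⟩
    by_contra hcl
    exact (hV ▸ (⟨hxO, hcl⟩ : x ∈ O \ closure G) : x ∈ (∅ : Set Z))
  · exact Or.inl ⟨hx, hxO⟩

/-- An analytic set is meagre or comeagre in some nonempty open set. -/
theorem AnalyticSet.isMeagre_or_exists_isOpen [SecondCountableTopology Z] [T2Space Z] {A : Set Z}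
    (hA : MeasureTheory.AnalyticSet A) :
    IsMeagre A ∨ ∃ W : Set Z, IsOpen W ∧ W.Nonempty ∧ IsMeagre (W \ A) := by
  rw [MeasureTheory.AnalyticSet] at hA
  rcases hA with rfl | ⟨f, hf, rfl⟩
  · exact Or.inl IsMeagre.empty
  -- `PiNat.res` puts the newest entry first, so the children of a node `s` are the lists `n :: s`.
  let B : List ℕ → Set Z := fun s => f '' {z | PiNat.res z s.length = s}
  have hBU (s : List ℕ) : B s = ⋃ n, B (n :: s) := by
    simp only [B, ← image_iUnion]
    congr 1
    ext z
    simp [PiNat.res_succ]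
  have hB0 : B [] = range f := by simp [B]
  have hm : IsMeagre (⋃ s, categoryClosure (B s) \ ⋃ n, categoryClosure (B (n :: s))) :=
    isMeagre_iUnion fun s => by
      nth_rewrite 1 [hBU s]
      exact isMeagre_categoryClosure_diff_iUnion _
  -- A point outside all these meagre differences stays in `categoryClosure (B s)` along an infinite
  -- branch `z`. By continuity the sets `B s` on the branch shrink to `f z`, so the point would be
  -- `f z`.
  have hsub : categoryClosure (range f) \ range f ⊆
      ⋃ s, categoryClosure (B s) \ ⋃ n, categoryClosure (B (n :: s)) := by
    rintro x ⟨hx, hxf⟩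
    by_contra hcon
    simp only [mem_iUnion, mem_sdiff, not_exists, not_and, not_forall, not_not] at hcon
    have hcon' : ∀ s, ∃ n, x ∈ categoryClosure (B s) → x ∈ categoryClosure (B (n :: s)) := by
      intro s
      by_cases h : x ∈ categoryClosure (B s)
      · obtain ⟨n, hn⟩ := hcon s h
        exact ⟨n, fun _ => hn⟩
      · exact ⟨0, fun h' => absurd h' h⟩
    choose g hg using hcon'
    let S : ℕ → List ℕ := fun n => Nat.rec [] (fun _ s => g s :: s) n
    let z : ℕ → ℕ := fun n => g (S n)
    have hS : ∀ n, PiNat.res z n = S n := by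
      intro n
      induction n with
      | zero => rfl
      | succ n ih => rw [PiNat.res_succ, ih]
    have hxS : ∀ n, x ∈ categoryClosure (B (S n)) := by
      intro n
      induction n with
      | zero => simpa [S, hB0] using hx
      | succ n ih => exact hg _ ih
    have hne : x ≠ f z := fun h => hxf ⟨z, h.symm⟩
    obtain ⟨U, V, hU, hV, hxU, hzV, hUV⟩ := t2_separation hne
    obtain ⟨n, hn⟩ : ∃ n, PiNat.cylinder z n ⊆ f ⁻¹' V := by
      obtain ⟨_, ⟨w, n, rfl⟩, hzw, hw⟩ := (PiNat.isTopologicalBasis_cylinders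
        (fun _ => ℕ)).exists_subset_of_mem_open (show z ∈ f ⁻¹' V from hzV) (hV.preimage hf)
      exact ⟨n, by rwa [PiNat.mem_cylinder_iff_eq.1 hzw]⟩
    obtain ⟨w, hwU, hw⟩ := mem_closure_iff.1 (categoryClosure_subset_closure _ (hxS n)) U hU hxU
    obtain ⟨t, ht, rfl⟩ := hw
    refine disjoint_left.1 hUV hwU (hn ?_)
    rw [PiNat.cylinder_eq_res]
    rw [← hS, mem_ofPred_eq, PiNat.res_length] at ht
    exact ht
  by_cases hi : interior (categoryClosure (range f)) = ∅
  · left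
    refine ((isMeagre_diff_categoryClosure (range f)).union
      ((isClosed_categoryClosure (range f)).isNowhereDense_iff.2 hi).isMeagre).mono ?_
    rw [sdiff_union_self]
    exact subset_union_left
  · right
    exact ⟨_, isOpen_interior, nonempty_iff_ne_empty.2 hi,
      (hm.mono hsub).mono (sdiff_subset_sdiff_left interior_subset)⟩

/-- Almost all vertical sections of a meagre set are meagre. -/
theorem IsMeagre.eventually_section {Y : Type*} [TopologicalSpace Y] [SecondCountableTopology Z]
    {M : Set (Y × Z)} (hM : IsMeagre M) :
    ∀ᶠ x in residual Y, IsMeagre {z | (x, z) ∈ M} := by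
  obtain ⟨S, hS, hSc, hMS⟩ := isMeagre_iff_countable_union_isNowhereDense.1 hM
  have key : ∀ F ∈ S, ∀ᶠ x in residual Y, IsNowhereDense {z | (x, z) ∈ F} := by
    intro F hF
    have hFn : IsNowhereDense (closure F) := (hS F hF).closure
    have h : ∀ B ∈ TopologicalSpace.countableBasis Z,
        ∀ᶠ x in residual Y, B.Nonempty → ∃ z ∈ B, (x, z) ∉ closure F := by
      intro B hB
      have hBo := TopologicalSpace.isOpen_of_mem_countableBasis hB
      by_cases hBn : B.Nonempty
      swap
      · exact Filter.Eventually.of_forall fun x h => absurd h hBn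
      -- This projection is open. It is also dense: an open `U` missing it would give a box `U ×ˢ B`
      -- inside the nowhere dense set `closure F`.
      have h1 : Prod.fst '' ((univ ×ˢ B) \ closure F) ∈ residual Y := by
        refine residual_of_dense_open
          (isOpenMap_fst _ ((isOpen_univ.prod hBo).sdiff isClosed_closure)) ?_
        rw [dense_iff_inter_open]
        intro U hU hUn
        by_contra hcon
        have hsub : U ×ˢ B ⊆ closure F := by
          rintro ⟨x, z⟩ ⟨hx, hz⟩
          by_contra hn
          exact hcon ⟨x, hx, (x, z), ⟨⟨mem_univ _, hz⟩, hn⟩, rfl⟩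
        have hsub' := interior_maximal hsub (hU.prod hBo)
        rw [isClosed_closure.isNowhereDense_iff.1 hFn] at hsub'
        exact (hUn.prod hBn).not_subset_empty hsub'
      filter_upwards [h1] with x hx _
      obtain ⟨⟨x', z⟩, ⟨⟨-, hz⟩, hn⟩, rfl⟩ := hx
      exact ⟨z, hz, hn⟩
    filter_upwards [(eventually_countable_ball
      (TopologicalSpace.countable_countableBasis Z)).2 h] with x hx
    have hcl : IsClosed {z | (x, z) ∈ closure F} :=
      isClosed_closure.preimage (Continuous.prodMk_right x)
    refine IsNowhereDense.mono (s := {z | (x, z) ∈ closure F}) (fun z hz => subset_closure hz) ?_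
    rw [hcl.isNowhereDense_iff, eq_empty_iff_forall_notMem]
    intro z hz
    obtain ⟨B, hB, hzB, hBU⟩ :=
      (TopologicalSpace.isBasis_countableBasis Z).exists_subset_of_mem_open hz isOpen_interior
    obtain ⟨z', hz', hn⟩ := hx B hB ⟨z, hzB⟩
    exact hn (show z' ∈ {z | (x, z) ∈ closure F} from interior_subset (hBU hz'))
  filter_upwards [(eventually_countable_ball hSc).2 key] with x hx
  have : IsMeagre (⋃ F ∈ S, {z | (x, z) ∈ F}) :=
    isMeagre_biUnion hSc fun F hF => (hx F hF).isMeagre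
  refine this.mono fun z hz => ?_
  obtain ⟨F, hF, hzF⟩ := hMS hz
  exact mem_biUnion hF hzF

end Category

/-! ### Combinatorics of finite and infinite block sequences. -/

section BlockSequences

theorem exists_antitone_of_mem_residual {Z : Type*} [TopologicalSpace Z] {C : Set Z}
    (hC : C ∈ residual Z) :
    ∃ D : ℕ → Set Z, Antitone D ∧ (∀ n, IsOpen (D n)) ∧ (∀ n, Dense (D n)) ∧ ⋂ n, D n ⊆ C := by
  obtain ⟨S, hSo, hSd, hSc, hSC⟩ := mem_residual_iff.1 hC
  obtain ⟨f, hf⟩ := (hSc.insert univ).exists_eq_range (insert_nonempty _ _)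
  have hfo : ∀ n, IsOpen (f n) ∧ Dense (f n) := fun n => by
    rcases (hf ▸ mem_range_self n : f n ∈ insert univ S) with h | h
    · rw [h]; exact ⟨isOpen_univ, dense_univ⟩
    · exact ⟨hSo _ h, hSd _ h⟩
  have hD : ∀ n, IsOpen (⋂ i ∈ Finset.range n, f i) ∧ Dense (⋂ i ∈ Finset.range n, f i) := by
    intro n
    induction n with
    | zero => simp
    | succ n ih =>
      rw [Finset.range_add_one, Finset.set_biInter_insert]
      exact ⟨(hfo n).1.inter ih.1, (hfo n).2.inter_of_isOpen_left ih.2 (hfo n).1⟩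
  refine ⟨fun n => ⋂ i ∈ Finset.range n, f i, ?_, fun n => (hD n).1, fun n => (hD n).2, ?_⟩
  · intro m n hmn x hx
    refine mem_iInter₂.2 fun i hi => mem_iInter₂.1 hx i ?_
    simp only [Finset.mem_range] at hi ⊢
    omega
  · refine Subset.trans ?_ hSC
    intro x hx s hs
    obtain ⟨i, rfl⟩ : s ∈ range f := hf ▸ mem_insert_of_mem _ hs
    exact mem_iInter₂.1 (mem_iInter.1 hx (i + 1)) i (by simp)

variable {Q : Type*}

/-- The list of the first `n` terms of a sequence. -/
def initial (x : ℕ → Q) (n : ℕ) : List Q := List.ofFn fun i : Fin n => x i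

@[simp] theorem length_initial (x : ℕ → Q) (n : ℕ) : (initial x n).length = n := by
  simp [initial]

theorem getElem?_initial (x : ℕ → Q) {n i : ℕ} (h : i < n) : (initial x n)[i]? = some (x i) := by
  simp [initial, h]

theorem initial_add (x : ℕ → Q) (m n : ℕ) :
    initial x (m + n) = initial x m ++ initial (fun i => x (m + i)) n := by
  simp [initial, List.ofFn_add]

theorem mem_initial {x : ℕ → Q} {n : ℕ} {q : Q} : q ∈ initial x n ↔ ∃ i < n, x i = q := by
  simp [initial, List.mem_ofFn, Fin.exists_iff]

theorem eq_of_initial_eq {x y : ℕ → Q} {n : ℕ} (h : initial x n = initial y n) {i : ℕ}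
    (hi : i < n) : x i = y i := by
  have := getElem?_initial x hi
  rw [h, getElem?_initial y hi] at this
  exact (Option.some.inj this).symm

/-- The list `s` is an initial segment of the sequence `x`. -/
def IsInitial (s : List Q) (x : ℕ → Q) : Prop := initial x s.length = s

theorem IsInitial.getElem? {s : List Q} {x : ℕ → Q} (h : IsInitial s x) {i : ℕ}
    (hi : i < s.length) : s[i]? = some (x i) := by
  rw [← getElem?_initial x hi, h]

theorem isInitial_of_getElem? {s : List Q} {x : ℕ → Q}
    (h : ∀ i < s.length, s[i]? = some (x i)) : IsInitial s x := by
  refine List.ext_getElem? fun i => ?_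
  by_cases hi : i < s.length
  · rw [getElem?_initial x hi, h i hi]
  · rw [List.getElem?_eq_none (by simpa using hi), List.getElem?_eq_none (by simpa using hi)]

theorem IsInitial.of_append {s t : List Q} {x : ℕ → Q} (h : IsInitial (s ++ t) x) :
    IsInitial s x := by
  unfold IsInitial at h ⊢
  rw [List.length_append, initial_add] at h
  exact (List.append_inj h (by simp)).1

theorem isInitial_initial (x : ℕ → Q) (n : ℕ) : IsInitial (initial x n) x := by
  simp [IsInitial]

theorem IsInitial.eq_of_mem {s : List Q} {x : ℕ → Q} (h : IsInitial s x) {q : Q} (hq : q ∈ s) :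
    q ∈ range x := by
  rw [← h, mem_initial] at hq
  obtain ⟨i, -, hi⟩ := hq
  exact ⟨i, hi⟩

theorem le_length_of_append {S : ℕ → List Q} (hS : ∀ k, ∃ w, w ≠ [] ∧ S (k + 1) = S k ++ w)
    (k : ℕ) : k ≤ (S k).length := by
  induction k with
  | zero => exact Nat.zero_le _
  | succ k ih =>
    obtain ⟨w, hw, h⟩ := hS k
    have := List.length_pos_of_ne_nil hw
    rw [h, List.length_append]
    omega

/-- A sequence of lists, each a strict initial segment of the next, has a limit. -/
theorem exists_limit (S : ℕ → List Q) (hS : ∀ k, ∃ w, w ≠ [] ∧ S (k + 1) = S k ++ w) :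
    ∃ x : ℕ → Q, (∀ k, IsInitial (S k) x) ∧ range x = {q | ∃ k, q ∈ S k} := by
  have hlen := le_length_of_append hS
  have hpre : ∀ k l, k ≤ l → S k <+: S l := by
    intro k l hkl
    induction l, hkl using Nat.le_induction with
    | base => exact List.prefix_refl _
    | succ l _ ih =>
      obtain ⟨w, hw, h⟩ := hS l
      rw [h]
      exact ih.trans (List.prefix_append _ _)
  have hget : ∀ k l i, i < (S k).length → i < (S l).length → (S k)[i]? = (S l)[i]? := by
    have : ∀ k l i, k ≤ l → i < (S k).length → (S k)[i]? = (S l)[i]? := by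
      intro k l i hkl hi
      obtain ⟨w, hw⟩ := hpre k l hkl
      rw [← hw, List.getElem?_append_left hi]
    intro k l i hk hl
    rcases le_total k l with h | h
    · exact this k l i h hk
    · exact (this l k i h hl).symm
  have hlt : ∀ i, i < (S (i + 1)).length := fun i => hlen (i + 1)
  have hini : ∀ k, IsInitial (S k) fun i => (S (i + 1))[i]'(hlt i) := fun k =>
    isInitial_of_getElem? fun i hi => by
      rw [hget k (i + 1) i hi (hlt i), List.getElem?_eq_getElem (hlt i)]
  refine ⟨_, hini, Subset.antisymm ?_ ?_⟩
  · rintro _ ⟨i, rfl⟩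
    exact ⟨i + 1, List.getElem_mem _⟩
  · rintro q ⟨k, hk⟩
    exact (hini k).eq_of_mem hk

variable {lo hi : Q → ℕ}

/-- The finite sequence `s` has successive supports `[lo q, hi q]`, contained in `[N, M)`. -/
structure BlockList (lo hi : Q → ℕ) (N M : ℕ) (s : List Q) : Prop where
  isChain : List.IsChain (fun a b => hi a < lo b) s
  le_lo : ∀ a ∈ s, N ≤ lo a
  hi_lt : ∀ a ∈ s, hi a < M

theorem BlockList.mono {N N' M M' : ℕ} {s : List Q} (h : BlockList lo hi N M s) (hN : N' ≤ N)
    (hM : M ≤ M') : BlockList lo hi N' M' s :=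
  ⟨h.isChain, fun a ha => hN.trans (h.le_lo a ha), fun a ha => (h.hi_lt a ha).trans_le hM⟩

theorem BlockList.append {N M K L : ℕ} {s t : List Q} (hs : BlockList lo hi N M s)
    (ht : BlockList lo hi K L t) (hNK : N ≤ K) (hMK : M ≤ K) (hML : M ≤ L) :
    BlockList lo hi N L (s ++ t) where
  isChain := List.isChain_append.2 ⟨hs.isChain, ht.isChain, fun a ha b hb =>
    (hs.hi_lt a (List.mem_of_getLast? ha)).trans_le
      (hMK.trans (ht.le_lo b (List.mem_of_head? hb)))⟩
  le_lo a ha := by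
    rcases List.mem_append.1 ha with h | h
    · exact hs.le_lo a h
    · exact hNK.trans (ht.le_lo a h)
  hi_lt a ha := by
    rcases List.mem_append.1 ha with h | h
    · exact (hs.hi_lt a h).trans_le hML
    · exact ht.hi_lt a h

theorem BlockList.nil (N M : ℕ) : BlockList lo hi N M [] :=
  ⟨List.isChain_nil, by simp, by simp⟩

theorem BlockList.singleton (q : Q) : BlockList lo hi (lo q) (hi q + 1) [q] :=
  ⟨List.isChain_singleton _, by simp, by simp⟩

theorem exists_hi_lt (s : List Q) : ∃ M, ∀ a ∈ s, hi a < M := by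
  induction s with
  | nil => exact ⟨0, by simp⟩
  | cons a s ih =>
    obtain ⟨M, hM⟩ := ih
    refine ⟨max M (hi a + 1), fun b hb => ?_⟩
    rcases List.mem_cons.1 hb with rfl | h
    · omega
    · have := hM b h
      omega

/-- The sequence `x` has successive supports `[lo (x n), hi (x n)]`. -/
def IsBlockSeq (lo hi : Q → ℕ) (x : ℕ → Q) : Prop := ∀ n, hi (x n) < lo (x (n + 1))

theorem IsBlockSeq.lt (hlh : ∀ q, lo q ≤ hi q) {x : ℕ → Q} (hx : IsBlockSeq lo hi x) {m n : ℕ}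
    (h : m < n) : hi (x m) < lo (x n) := by
  induction n, h using Nat.le_induction with
  | base => exact hx m
  | succ n _ ih => exact (ih.trans_le (hlh _)).trans (hx n)

theorem IsBlockSeq.blockList (hlh : ∀ q, lo q ≤ hi q) {x : ℕ → Q} (hx : IsBlockSeq lo hi x)
    (m n : ℕ) :
    BlockList lo hi (lo (x m)) (lo (x (m + n))) (initial (fun i => x (m + i)) n) where
  isChain := by
    rw [List.isChain_iff_getElem]
    intro i hi
    simp only [initial, List.getElem_ofFn]
    exact hx (m + i)
  le_lo a ha := by
    obtain ⟨i, -, rfl⟩ := mem_initial.1 ha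
    rcases Nat.eq_zero_or_pos i with rfl | h
    · rfl
    · exact (hlh _).trans (hx.lt hlh (by omega)).le
  hi_lt a ha := by
    obtain ⟨i, h, rfl⟩ := mem_initial.1 ha
    exact hx.lt hlh (by omega)

theorem isBlockSeq_of_isInitial {x : ℕ → Q}
    (h : ∀ n, ∃ s : List Q, n < s.length ∧ List.IsChain (fun a b => hi a < lo b) s ∧
      IsInitial s x) : IsBlockSeq lo hi x := by
  intro n
  obtain ⟨s, hn, hs, hsx⟩ := h (n + 1)
  have := List.isChain_iff_getElem.1 hs n hn
  have h1 := hsx.getElem? hn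
  have h2 := hsx.getElem? (i := n) (by omega)
  rw [List.getElem?_eq_getElem (by omega)] at h1 h2
  rwa [Option.some.inj h1, Option.some.inj h2] at this

/-- A limit of block lists is a block sequence. -/
theorem exists_limit_isBlockSeq (S : ℕ → List Q)
    (hS : ∀ k, ∃ w, w ≠ [] ∧ S (k + 1) = S k ++ w)
    (hc : ∀ k, List.IsChain (fun a b => hi a < lo b) (S k)) :
    ∃ x : ℕ → Q, IsBlockSeq lo hi x ∧ (∀ k, IsInitial (S k) x) ∧
      range x = {q | ∃ k, q ∈ S k} := by
  obtain ⟨x, hx, hr⟩ := exists_limit S hS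
  refine ⟨x, isBlockSeq_of_isInitial fun n => ?_, hx, hr⟩
  have hlen := le_length_of_append hS
  exact ⟨S (n + 1), hlen _, hc _, hx _⟩

theorem exists_isBlockSeq_isInitial (hlh : ∀ q, lo q ≤ hi q) (hex : ∀ n, ∃ q, n ≤ lo q) {s : List Q}
    (hs : List.IsChain (fun a b => hi a < lo b) s) :
    ∃ x : ℕ → Q, IsBlockSeq lo hi x ∧ IsInitial s x := by
  choose g hg using hex
  have hM : ∀ s : List Q, ∃ M, ∀ a ∈ s, hi a < M := exists_hi_lt
  choose M hM using hM
  let S : ℕ → List Q := fun n => Nat.rec s (fun _ t => t ++ [g (M t)]) n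
  have hS : ∀ k, S (k + 1) = S k ++ [g (M (S k))] := fun k => rfl
  obtain ⟨x, hx, hx', -⟩ := exists_limit_isBlockSeq (lo := lo) (hi := hi) S
    (fun k => ⟨_, by simp, hS k⟩) (fun k => by
      induction k with
      | zero => exact hs
      | succ k ih =>
        rw [hS]
        exact ((BlockList.mk ih (fun _ _ => Nat.zero_le _) (hM _)).append
          (BlockList.singleton (g (M (S k)))) (Nat.zero_le _) (hg _)
            ((hg _).trans ((hlh _).trans (Nat.le_succ _)))).isChain)
  exact ⟨x, hx, hx' 0⟩

variable {p : (ℕ → Q) → Prop}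

/-- The basic open set of block sequences beginning with `s`. -/
def cyl (p : (ℕ → Q) → Prop) (s : List Q) : Set {x // p x} := {x | IsInitial s x.1}

theorem mem_cyl {s : List Q} {x : {x // p x}} : x ∈ cyl p s ↔ IsInitial s x.1 := Iff.rfl

theorem cyl_append_subset (s t : List Q) : cyl p (s ++ t) ⊆ cyl p s :=
  fun _ hx => IsInitial.of_append hx

theorem exists_mem_cyl (hlh : ∀ q, lo q ≤ hi q) (hex : ∀ n, ∃ q, n ≤ lo q)
    (hp : ∀ x, p x ↔ IsBlockSeq lo hi x) {N M : ℕ} {s : List Q} (hs : BlockList lo hi N M s) :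
    (cyl p s).Nonempty := by
  obtain ⟨x, hx, hsx⟩ := exists_isBlockSeq_isInitial hlh hex hs.isChain
  exact ⟨⟨x, (hp x).2 hx⟩, hsx⟩

/-- A block list can be continued to any larger length. -/
theorem exists_append_length_eq (hlh : ∀ q, lo q ≤ hi q) (hex : ∀ n, ∃ q, n ≤ lo q) {N M : ℕ}
    (hNM : N ≤ M) {s : List Q} (hs : BlockList lo hi N M s) (n : ℕ) :
    ∃ w L, M ≤ L ∧ BlockList lo hi N L (s ++ w) ∧ w.length = n := by
  induction n with
  | zero => exact ⟨[], M, le_rfl, by simpa using hs, rfl⟩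
  | succ n ih =>
    obtain ⟨w, L, hL, hw, hn⟩ := ih
    obtain ⟨q, hq⟩ := hex L
    refine ⟨w ++ [q], hi q + 1, by have := hlh q; omega, ?_, by simp [hn]⟩
    rw [← List.append_assoc]
    exact hw.append (BlockList.singleton q) (by omega) hq (by have := hlh q; omega)

end BlockSequences

/-! ### Topology of the space of block sequences. -/

section BlockSpace

variable {Q : Type*} [TopologicalSpace Q] [DiscreteTopology Q] {lo hi : Q → ℕ}
  {p : (ℕ → Q) → Prop}

theorem continuous_initial {A : Type*} [TopologicalSpace A] [DiscreteTopology A]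
    (L n : ℕ) (F : List Q → Q → A) :
    Continuous fun x : {x // p x} => F (initial x.1 L) (x.1 n) := by
  have h1 : Continuous fun x : {x // p x} => ((fun i : Fin L => x.1 i), x.1 n) :=
    (continuous_pi fun i => (continuous_apply _).comp continuous_subtype_val).prodMk
      ((continuous_apply n).comp continuous_subtype_val)
  have h2 : Continuous fun y : (Fin L → Q) × Q => F (List.ofFn y.1) y.2 :=
    continuous_of_discreteTopology
  exact h2.comp h1

theorem isOpen_cyl (s : List Q) : IsOpen (cyl p s) := by
  have h : Continuous fun x : {x // p x} => fun i : Fin s.length => x.1 i :=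
    continuous_pi fun i => (continuous_apply _).comp continuous_subtype_val
  exact (isOpen_discrete {y : Fin s.length → Q | List.ofFn y = s}).preimage h

theorem exists_initial_subset {U : Set {x // p x}} (hU : IsOpen U) {x : {x // p x}} (hx : x ∈ U) :
    ∃ n, ∀ y : {x // p x}, (∀ i < n, y.1 i = x.1 i) → y ∈ U := by
  obtain ⟨V, hV, rfl⟩ := isOpen_induced_iff.1 hU
  obtain ⟨_, ⟨w, n, rfl⟩, hzw, hw⟩ := (PiNat.isTopologicalBasis_cylinders
        (fun _ => Q)).exists_subset_of_mem_open (show x.1 ∈ V from hx) hV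
  refine ⟨n, fun y hy => hw ?_⟩
  rw [PiNat.mem_cylinder_iff] at hzw ⊢
  exact fun i hi => (hy i hi).trans (hzw i hi)

theorem exists_cyl_subset (hlh : ∀ q, lo q ≤ hi q) (hp : ∀ x, p x ↔ IsBlockSeq lo hi x)
    {U : Set {x // p x}} (hU : IsOpen U) {s : List Q} {q : Q} {x : {x // p x}} (hx : x ∈ U)
    (hs : IsInitial (s ++ [q]) x.1) :
    ∃ w M, w ≠ [] ∧ BlockList lo hi (lo q) M w ∧ cyl p (s ++ w) ⊆ U := by
  obtain ⟨n, hn⟩ := exists_initial_subset hU hx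
  have hxs : IsInitial s x.1 := hs.of_append
  -- Taking `n + 1` terms after `s` makes `w` nonempty, and together with `s` it fixes at least the
  -- `n` terms that decide membership in `U`. Its first term is `q`, which bounds the supports from
  -- below.
  refine ⟨initial (fun i => x.1 (s.length + i)) (n + 1), lo (x.1 (s.length + (n + 1))), ?_, ?_, ?_⟩
  · intro h
    simpa using congrArg List.length h
  · have hq : x.1 s.length = q := by
      have := hs.getElem? (i := s.length) (by simp)
      simpa using this.symm
    have := IsBlockSeq.blockList hlh ((hp _).1 x.2) s.length (n + 1)
    rwa [hq] at this
  · intro y hy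
    refine hn y fun i hi => ?_
    rw [mem_cyl, ← hxs, length_initial, ← initial_add, IsInitial, length_initial] at hy
    exact eq_of_initial_eq hy (by omega)

/-- A block list can be continued so as to enter a given dense open set. -/
theorem exists_append_subset_dense (hlh : ∀ q, lo q ≤ hi q) (hex : ∀ n, ∃ q, n ≤ lo q)
    (hp : ∀ x, p x ↔ IsBlockSeq lo hi x) {D : Set {x // p x}} (hD : IsOpen D) (hDd : Dense D)
    {N M : ℕ} {s : List Q} (hs : BlockList lo hi N M s) (K : ℕ) (hMK : M ≤ K) :
    ∃ w L, w ≠ [] ∧ BlockList lo hi K L w ∧ cyl p (s ++ w) ⊆ D := by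
  -- Prescribing `q` as the next term forces the whole continuation to be supported at or after `K`.
  obtain ⟨q, hq⟩ := hex K
  have h1 : BlockList lo hi 0 (hi q + 1) (s ++ [q]) :=
    (hs.mono (Nat.zero_le _) le_rfl).append (BlockList.singleton q) (Nat.zero_le _) (by omega)
      (by have := hlh q; omega)
  obtain ⟨x, hx, hxD⟩ := hDd.inter_open_nonempty _ (isOpen_cyl (p := p) (s ++ [q]))
    (exists_mem_cyl hlh hex hp h1)
  obtain ⟨w, L, hw, hwb, hsub⟩ := exists_cyl_subset hlh hp hD hxD hx
  exact ⟨w, L, hw, hwb.mono hq le_rfl, hsub⟩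

/-- Two block lists can be continued so as to enter a given dense open subset of the square. -/
theorem exists_append_prod_subset_dense (hlh : ∀ q, lo q ≤ hi q) (hex : ∀ n, ∃ q, n ≤ lo q)
    (hp : ∀ x, p x ↔ IsBlockSeq lo hi x) {D : Set ({x // p x} × {x // p x})} (hD : IsOpen D)
    (hDd : Dense D) {N M : ℕ} {s t : List Q} (hs : BlockList lo hi N M s)
    (ht : BlockList lo hi N M t) (K : ℕ) (hMK : M ≤ K) :
    ∃ v w L, BlockList lo hi K L v ∧ BlockList lo hi K L w ∧
      cyl p (s ++ v) ×ˢ cyl p (t ++ w) ⊆ D := by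
  obtain ⟨q, hq⟩ := hex K
  have h1 : ∀ r, BlockList lo hi N M r → BlockList lo hi 0 (hi q + 1) (r ++ [q]) := fun r hr =>
    (hr.mono (Nat.zero_le _) le_rfl).append (BlockList.singleton q) (Nat.zero_le _) (by omega)
      (by have := hlh q; omega)
  obtain ⟨⟨x, y⟩, ⟨hx, hy⟩, hxD⟩ := hDd.inter_open_nonempty _
    ((isOpen_cyl (p := p) (s ++ [q])).prod (isOpen_cyl (p := p) (t ++ [q])))
    ((exists_mem_cyl hlh hex hp (h1 s hs)).prod (exists_mem_cyl hlh hex hp (h1 t ht)))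
  obtain ⟨U, V, hU, hV, hxU, hyV, hUV⟩ := isOpen_prod_iff.1 hD x y hxD
  obtain ⟨v, L, -, hv, hvs⟩ := exists_cyl_subset hlh hp hU hxU hx
  obtain ⟨w, L', -, hw, hws⟩ := exists_cyl_subset hlh hp hV hyV hy
  exact ⟨v, w, max L L', hv.mono hq (le_max_left _ _), hw.mono hq (le_max_right _ _),
    (prod_mono hvs hws).trans hUV⟩

/-- The same `v` and `w` serve all pairs: they are lengthened for one pair at a time, and
lengthening preserves the inclusions already obtained because cylinders shrink. -/
theorem exists_append_prod_subset_dense_of_finite (hlh : ∀ q, lo q ≤ hi q)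
    (hex : ∀ n, ∃ q, n ≤ lo q) (hp : ∀ x, p x ↔ IsBlockSeq lo hi x)
    {D : Set ({x // p x} × {x // p x})} (hD : IsOpen D)
    (hDd : Dense D) {N M : ℕ} {R : Set (List Q × List Q)} (hR : R.Finite)
    (hRb : ∀ r ∈ R, BlockList lo hi N M r.1 ∧ BlockList lo hi N M r.2) :
    ∃ v w L, M ≤ L ∧ BlockList lo hi M L v ∧ BlockList lo hi M L w ∧
      ∀ r ∈ R, cyl p (r.1 ++ v) ×ˢ cyl p (r.2 ++ w) ⊆ D := by
  induction R, hR using Set.Finite.induction_on with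
  | empty => exact ⟨[], [], M, le_rfl, .nil _ _, .nil _ _, by simp⟩
  | @insert r R _ _ ih =>
    obtain ⟨v, w, L, hML, hv, hw, h⟩ := ih fun r' hr' => hRb r' (mem_insert_of_mem _ hr')
    obtain ⟨hr1, hr2⟩ := hRb r (mem_insert _ _)
    obtain ⟨v', w', L', hv', hw', h'⟩ := exists_append_prod_subset_dense hlh hex hp hD hDd
      ((hr1.mono (Nat.zero_le _) le_rfl).append hv (Nat.zero_le _) le_rfl hML)
      ((hr2.mono (Nat.zero_le _) le_rfl).append hw (Nat.zero_le _) le_rfl hML) L le_rfl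
    refine ⟨v ++ v', w ++ w', max L L', by omega,
      hv.append (hv'.mono le_rfl (le_max_right _ _)) hML le_rfl (le_max_left _ _),
      hw.append (hw'.mono le_rfl (le_max_right _ _)) hML le_rfl (le_max_left _ _), ?_⟩
    rintro r' (rfl | hr')
    · simpa only [List.append_assoc] using h'
    · simp only [← List.append_assoc]
      exact (prod_mono (cyl_append_subset _ _) (cyl_append_subset _ _)).trans (h r' hr')

end BlockSpace

/-! ### Finite changes of block sequences and the zero-one law. -/

section Dichotomy

variable {Q : Type*} {lo hi : Q → ℕ} {p : (ℕ → Q) → Prop}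

/-- The sequence `x` with its first terms replaced by the list `r`. -/
def splice (r : List Q) (x : ℕ → Q) (n : ℕ) : Q := r[n]?.getD (x n)

theorem splice_of_lt {r : List Q} {x : ℕ → Q} {n : ℕ} (h : n < r.length) :
    splice r x n = r[n] := by
  simp [splice, h]

theorem splice_of_le {r : List Q} {x : ℕ → Q} {n : ℕ} (h : r.length ≤ n) :
    splice r x n = x n := by
  simp [splice, h]

theorem isInitial_splice (r : List Q) (x : ℕ → Q) : IsInitial r (splice r x) :=
  isInitial_of_getElem? fun i hi => by rw [splice_of_lt hi, List.getElem?_eq_getElem hi]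

theorem IsInitial.splice_eq {r : List Q} {x : ℕ → Q} (h : IsInitial r x) : splice r x = x := by
  funext n
  by_cases hn : n < r.length
  · simp [splice, h.getElem? hn]
  · exact splice_of_le (by omega)

/-- The replaced segment ends in the same term `q` as before, so the junction with the tail is
unaffected. -/
theorem IsBlockSeq.splice {r : List Q} {x : ℕ → Q} {q : Q} (hx : IsBlockSeq lo hi x)
    (hr : List.IsChain (fun a b => hi a < lo b) (r ++ [q])) (hq : x r.length = q) :
    IsBlockSeq lo hi (splice (r ++ [q]) x) := by
  intro n
  by_cases h1 : n + 1 < (r ++ [q]).length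
  · rw [splice_of_lt h1, splice_of_lt (by omega)]
    exact List.isChain_iff_getElem.1 hr n h1
  · rw [splice_of_le (n := n + 1) (by omega)]
    by_cases h2 : n < (r ++ [q]).length
    · rw [splice_of_lt h2]
      have hn : n = r.length := by simp at h1 h2; omega
      subst hn
      simpa [← hq] using hx r.length
    · rw [splice_of_le (by omega)]
      exact hx n

/-- An involution exchanging the block sequences that begin with `s` and those that begin with
`t`, and changing only finitely many terms of each sequence. -/
theorem exists_swap [TopologicalSpace Q] [DiscreteTopology Q]
    (hp : ∀ x, p x ↔ IsBlockSeq lo hi x) {s t : List Q} {q : Q}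
    (hs : List.IsChain (fun a b => hi a < lo b) (s ++ [q]))
    (ht : List.IsChain (fun a b => hi a < lo b) (t ++ [q])) (hst : s.length = t.length) :
    ∃ h : {x // p x} → {x // p x}, Continuous h ∧ Function.Involutive h ∧
      (∀ x n, s.length + 1 ≤ n → (h x).1 n = x.1 n) ∧
      ∀ x ∈ cyl p (t ++ [q]), h x ∈ cyl p (s ++ [q]) := by
  classical
  let σ : Equiv.Perm (List Q) := Equiv.swap (s ++ [q]) (t ++ [q])
  have hσ : ∀ r, (σ r).length = r.length := by
    intro r
    by_cases h1 : r = s ++ [q]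
    · simp [σ, h1, hst]
    by_cases h2 : r = t ++ [q]
    · simp [σ, h2, hst]
    · simp only [σ, Equiv.swap_apply_of_ne_of_ne h1 h2]
  have hb : ∀ x, p x → p (splice (σ (initial x (s.length + 1))) x) := by
    intro x hx
    by_cases h1 : initial x (s.length + 1) = s ++ [q]
    · have hx1 : IsInitial (s ++ [q]) x := by simpa [IsInitial] using h1
      have hq : x s.length = q := by simpa using (hx1.getElem? (i := s.length) (by simp)).symm
      simp only [σ, h1, Equiv.swap_apply_left]
      exact (hp _).2 (((hp _).1 hx).splice ht (hst ▸ hq))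
    by_cases h2 : initial x (s.length + 1) = t ++ [q]
    · have hx1 : IsInitial (t ++ [q]) x := by simpa [IsInitial, ← hst] using h2
      have hq : x t.length = q := by simpa using (hx1.getElem? (i := t.length) (by simp)).symm
      simp only [σ, h2, Equiv.swap_apply_right]
      exact (hp _).2 (((hp _).1 hx).splice hs (hst ▸ hq))
    · simp only [σ, Equiv.swap_apply_of_ne_of_ne h1 h2]
      rwa [(isInitial_initial x _).splice_eq]
  have hini : ∀ x, initial (splice (σ (initial x (s.length + 1))) x) (s.length + 1) =
      σ (initial x (s.length + 1)) := by
    intro x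
    have := isInitial_splice (σ (initial x (s.length + 1))) x
    rwa [IsInitial, hσ, length_initial] at this
  refine ⟨fun x => ⟨_, hb x.1 x.2⟩, ?_, ?_, ?_, ?_⟩
  · refine Continuous.subtype_mk (continuous_pi fun n => ?_) _
    exact continuous_initial (s.length + 1) n fun l a => (σ l)[n]?.getD a
  · intro x
    apply Subtype.ext
    simp only [hini]
    funext n
    by_cases hn : n < s.length + 1
    · have : σ (σ (initial x.1 (s.length + 1))) = initial x.1 (s.length + 1) :=
        Equiv.swap_apply_self _ _ _
      simp [this, splice, getElem?_initial x.1 hn]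
    · rw [splice_of_le (by simp only [hσ, length_initial]; omega),
        splice_of_le (by simp only [hσ, length_initial]; omega)]
  · intro x n hn
    exact splice_of_le (by simpa only [hσ, length_initial] using hn)
  · intro x hx
    have h2 : initial x.1 (s.length + 1) = t ++ [q] := by
      have : IsInitial (t ++ [q]) x.1 := hx
      simpa [IsInitial, ← hst] using this
    have := isInitial_splice (s ++ [q]) x.1
    show IsInitial _ _
    simpa only [h2, σ, Equiv.swap_apply_right] using this

/-- Zero-one law: a set of block sequences that is closed under finite changes and comeagre in some
basic open set is comeagre. -/
theorem mem_residual_of_isMeagre_cyl_diff [TopologicalSpace Q] [DiscreteTopology Q] [Countable Q]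
    (hlh : ∀ q, lo q ≤ hi q) (hex : ∀ n, ∃ q, n ≤ lo q)
    (hp : ∀ x, p x ↔ IsBlockSeq lo hi x) {C : Set {x // p x}}
    (hC : ∀ x y : {x // p x}, (∃ L, ∀ n, L ≤ n → x.1 n = y.1 n) → x ∈ C → y ∈ C)
    {N M : ℕ} {s : List Q} (hs : BlockList lo hi N M s) (hm : IsMeagre (cyl p s \ C)) :
    C ∈ residual {x // p x} := by
  let T : Set (List Q) := {t | IsMeagre (cyl p t \ C)}
  have h1 : IsMeagre (⋃ t ∈ T, cyl p t \ C) := isMeagre_biUnion (to_countable T) fun t ht => ht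
  have ho : IsOpen (⋃ t ∈ T, cyl p t) := isOpen_biUnion fun t _ => isOpen_cyl t
  -- Inside any cylinder, the given initial segment and `s` are continued to equal length and closed
  -- off by a common term `q`. The swap homeomorphism then carries the hypothesis on `cyl p s` over
  -- to the new cylinder.
  have hd : Dense (⋃ t ∈ T, cyl p t) := by
    rw [dense_iff_inter_open]
    rintro U hU ⟨x, hx⟩
    obtain ⟨n, hn⟩ := exists_initial_subset hU hx
    obtain ⟨M', hM'⟩ := exists_hi_lt (hi := hi) (initial x.1 n)
    have ht : BlockList lo hi 0 M' (initial x.1 n) := by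
      refine ⟨?_, fun _ _ => Nat.zero_le _, hM'⟩
      simpa using (IsBlockSeq.blockList hlh ((hp _).1 x.2) 0 n).isChain
    obtain ⟨w, L, hL, hw, hwl⟩ := exists_append_length_eq hlh hex (Nat.zero_le _) ht s.length
    obtain ⟨w', L', hL', hw', hwl'⟩ := exists_append_length_eq hlh hex (Nat.zero_le _)
      (hs.mono (Nat.zero_le _) le_rfl) n
    obtain ⟨q, hq⟩ := hex (max L L')
    have hlq := hlh q
    have hwq := hw.append (BlockList.singleton q) (Nat.zero_le _) (by omega) (by omega)
    have hwq' := hw'.append (BlockList.singleton q) (Nat.zero_le _) (by omega) (by omega)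
    obtain ⟨h, hc, hinv, htail, hmap⟩ := exists_swap hp hwq'.isChain hwq.isChain
      (by simp [hwl, hwl', add_comm])
    have hopen : IsOpenMap h := (Homeomorph.mk hinv.toPerm hc hc).isOpenMap
    have hT : (initial x.1 n ++ w) ++ [q] ∈ T := by
      refine (hm.preimage_of_isOpenMap hc hopen).mono ?_
      rintro y ⟨hy, hyC⟩
      refine ⟨?_, fun hcon => hyC (hC (h y) y ⟨_, htail y⟩ hcon)⟩
      have := hmap y hy
      rw [List.append_assoc] at this
      exact cyl_append_subset _ _ this
    obtain ⟨y, hy⟩ := exists_mem_cyl (p := p) hlh hex hp hwq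
    refine ⟨y, hn y fun i hi => ?_, mem_biUnion hT hy⟩
    have hy' : IsInitial (initial x.1 n) y.1 := by
      have hy : IsInitial _ y.1 := hy
      rw [List.append_assoc] at hy
      exact hy.of_append
    rw [IsInitial, length_initial] at hy'
    exact eq_of_initial_eq hy' hi
  filter_upwards [residual_of_dense_open ho hd, h1] with x hx hx'
  by_contra hxC
  obtain ⟨t, ht, hxt⟩ := mem_iUnion₂.1 hx
  exact hx' (mem_biUnion ht ⟨hxt, hxC⟩)

end Dichotomy

/-! ### Reduction of `E₀` to a meagre relation, and the dichotomy. -/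

section Dichotomy

variable {Q : Type*} {lo hi : Q → ℕ} {p : (ℕ → Q) → Prop}

/-- Splitting step of the tree: two branches taking different values at this level land in `D`,
whatever their histories `s` and `t`. Equal lengths keep later terms aligned between branches. -/
theorem exists_pair_append [TopologicalSpace Q] [DiscreteTopology Q]
    (hlh : ∀ q, lo q ≤ hi q) (hex : ∀ n, ∃ q, n ≤ lo q) (hp : ∀ x, p x ↔ IsBlockSeq lo hi x)
    {D : Set ({x // p x} × {x // p x})} (hD : IsOpen D) (hDd : Dense D) (M : ℕ)
    {T : Set (List Q)} (hT : T.Finite) (hTb : ∀ s ∈ T, BlockList lo hi 0 M s) :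
    ∃ (v : Bool → List Q) (L : ℕ), M ≤ L ∧ (∀ b, v b ≠ []) ∧ (∀ b, BlockList lo hi M L (v b)) ∧
      (v false).length = (v true).length ∧
      ∀ s ∈ T, ∀ t ∈ T, ∀ b, cyl p (s ++ v b) ×ˢ cyl p (t ++ v !b) ⊆ D := by
  -- Symmetrizing `D` treats `(false, true)` and `(true, false)` at once.
  have hD' : IsOpen (D ∩ Prod.swap ⁻¹' D) := hD.inter (hD.preimage continuous_swap)
  have hDd' : Dense (D ∩ Prod.swap ⁻¹' D) :=
    hDd.inter_of_isOpen_left (hDd.preimage (Homeomorph.prodComm _ _).isOpenMap) hD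
  obtain ⟨v, w, L, hML, hv, hw, h⟩ := exists_append_prod_subset_dense_of_finite hlh hex hp hD' hDd'
    (hT.prod hT) (N := 0) (M := M) fun r hr => ⟨hTb _ hr.1, hTb _ hr.2⟩
  -- Both continuations receive total length `v.length + w.length + 1`; the extra term makes them
  -- nonempty.
  obtain ⟨v', L1, hL1, hv', hvl⟩ := exists_append_length_eq hlh hex hML hv (w.length + 1)
  obtain ⟨w', L2, hL2, hw', hwl⟩ := exists_append_length_eq hlh hex hML hw (v.length + 1)
  have h' : ∀ s ∈ T, ∀ t ∈ T, cyl p (s ++ (v ++ v')) ×ˢ cyl p (t ++ (w ++ w')) ⊆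
      D ∩ Prod.swap ⁻¹' D := by
    intro s hs t ht
    rw [← List.append_assoc, ← List.append_assoc]
    exact (prod_mono (cyl_append_subset _ _) (cyl_append_subset _ _)).trans (h (s, t) ⟨hs, ht⟩)
  refine ⟨fun b => if b then w ++ w' else v ++ v', max L1 L2, by omega, ?_, ?_, ?_, ?_⟩
  · intro b
    cases b
    · simp only [Bool.false_eq_true, if_false]
      exact List.ne_nil_of_length_pos (by simp [hvl])
    · simp only [if_true]
      exact List.ne_nil_of_length_pos (by simp [hwl])
  · intro b
    cases b
    · simpa using hv'.mono le_rfl (le_max_left _ _)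
    · simpa using hw'.mono le_rfl (le_max_right _ _)
  · simp [hvl, hwl]; omega
  · intro s hs t ht b
    cases b
    · simpa using (h' s hs t ht).trans inter_subset_left
    · rintro ⟨x, y⟩ ⟨hx, hy⟩
      exact (h' t ht s hs (show (y, x) ∈ _ from ⟨by simpa using hy, by simpa using hx⟩)).2

/-- If `E` is a meagre equivalence relation on block sequences that contains eventual equality, then
`E₀` reduces continuously to `E`. -/
theorem exists_continuous_reduction [TopologicalSpace Q] [DiscreteTopology Q]
    (hlh : ∀ q, lo q ≤ hi q) (hex : ∀ n, ∃ q, n ≤ lo q) (hp : ∀ x, p x ↔ IsBlockSeq lo hi x)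
    {E : {x // p x} → {x // p x} → Prop}
    (htail : ∀ x y : {x // p x}, (∃ L, ∀ n, L ≤ n → x.1 n = y.1 n) → E x y)
    (hE : IsMeagre {z : {x // p x} × {x // p x} | E z.1 z.2}) :
    ∃ f : (ℕ → Bool) → {x // p x}, Continuous f ∧ ∀ α β, E₀ α β ↔ E (f α) (f β) := by
  obtain ⟨D, hDa, hDo, hDd, hDE⟩ := exists_antitone_of_mem_residual hE
  -- A state records all the lists on one level of the tree together with a common bound for their
  -- supports.
  let State := {z : Set (List Q) × ℕ // z.1.Finite ∧ ∀ s ∈ z.1, BlockList lo hi 0 z.2 s}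
  have hstep : ∀ (n : ℕ) (z : State), ∃ (v : Bool → List Q) (L : ℕ), z.1.2 ≤ L ∧
      (∀ b, v b ≠ []) ∧ (∀ b, BlockList lo hi z.1.2 L (v b)) ∧
      (v false).length = (v true).length ∧
      ∀ s ∈ z.1.1, ∀ t ∈ z.1.1, ∀ b, cyl p (s ++ v b) ×ˢ cyl p (t ++ v !b) ⊆ D n :=
    fun n z => exists_pair_append hlh hex hp (hDo n) (hDd n) z.1.2 z.2.1 z.2.2
  choose v L hL hne hbl hlen hsub using hstep
  let next : ℕ → State → State := fun n z =>
    ⟨(⋃ b, (fun s => s ++ v n z b) '' z.1.1, L n z),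
      finite_iUnion fun b => z.2.1.image _, by
        intro s hs
        obtain ⟨b, t, ht, rfl⟩ := mem_iUnion.1 hs
        exact (z.2.2 t ht).append (hbl n z b) (Nat.zero_le _) le_rfl (hL n z)⟩
  let Z : ℕ → State := fun n =>
    Nat.rec ⟨({[]}, 0), finite_singleton _, by
      intro s hs; rw [mem_singleton_iff.1 hs]; exact .nil _ _⟩ next n
  have hZ : ∀ n, Z (n + 1) = next n (Z n) := fun n => rfl
  let S : (ℕ → Bool) → ℕ → List Q := fun α n =>
    Nat.rec [] (fun k s => s ++ v k (Z k) (α k)) n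
  have hS : ∀ α n, S α (n + 1) = S α n ++ v n (Z n) (α n) := fun α n => rfl
  have hSZ : ∀ α n, S α n ∈ (Z n).1.1 := by
    intro α n
    induction n with
    | zero => exact mem_singleton _
    | succ n ih => exact mem_iUnion.2 ⟨α n, S α n, ih, rfl⟩
  have hlim : ∀ α, ∃ x : ℕ → Q, IsBlockSeq lo hi x ∧ ∀ k, IsInitial (S α k) x := by
    intro α
    obtain ⟨x, hx, hx', -⟩ := exists_limit_isBlockSeq (lo := lo) (hi := hi) (S α)
      (fun k => ⟨_, hne k (Z k) (α k), hS α k⟩) fun k => ((Z k).2.2 _ (hSZ α k)).isChain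
    exact ⟨x, hx, hx'⟩
  choose f hf hfS using hlim
  have hlenS : ∀ α k, k ≤ (S α k).length := fun α k =>
    le_length_of_append (fun k => ⟨_, hne k (Z k) (α k), hS α k⟩) k
  have hvlen : ∀ n z b c, (v n z b).length = (v n z c).length := by
    intro n z b c
    cases b <;> cases c <;> simp [hlen]
  have hlenEq : ∀ α β k, (S α k).length = (S β k).length := by
    intro α β k
    induction k with
    | zero => rfl
    | succ k ih => rw [hS, hS, List.length_append, List.length_append, ih, hvlen]
  refine ⟨fun α => ⟨f α, (hp _).2 (hf α)⟩, ?_, ?_⟩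
  · refine Continuous.subtype_mk (continuous_pi fun n => ?_) _
    refine IsLocallyConstant.continuous (f := fun α => f α n) ?_
    have hSl : ∀ k, IsLocallyConstant fun α => S α k := by
      intro k
      induction k with
      | zero => exact IsLocallyConstant.const []
      | succ k ih =>
        have h2 : IsLocallyConstant fun α : ℕ → Bool => v k (Z k) (α k) :=
          (IsLocallyConstant.iff_continuous _ |>.2 (continuous_apply k)).comp _
        exact ih.comp₂ h2 fun a b => a ++ b
    have h3 : (fun α => some (f α n)) = fun α => (S α (n + 1))[n]? := by
      funext α
      exact ((hfS α (n + 1)).getElem? (hlenS α (n + 1))).symm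
    have h4 : IsLocallyConstant fun α => some (f α n) := by
      rw [h3]
      exact (hSl (n + 1)).comp fun s : List Q => s[n]?
    exact IsLocallyConstant.desc _ some h4 (Option.some_injective _)
  · intro α β
    constructor
    · rintro ⟨n, hn⟩
      -- At level `n` both lists have the same length, so the equal blocks appended afterwards
      -- occupy equal positions.
      refine htail _ _ ⟨(S α n).length, ?_⟩
      have key : ∀ k, n ≤ k → ∃ w, S α k = S α n ++ w ∧ S β k = S β n ++ w := by
        intro k hk
        induction k, hk using Nat.le_induction with
        | base => exact ⟨[], by simp, by simp⟩
        | succ k hk ih =>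
          obtain ⟨w, h1, h2⟩ := ih
          exact ⟨w ++ v k (Z k) (α k), by rw [hS, h1, List.append_assoc],
            by rw [hS, h2, ← hn k hk, List.append_assoc]⟩
      intro i hi
      obtain ⟨w, h1, h2⟩ := key (n + i + 1) (by omega)
      have h3 := (hfS α (n + i + 1)).getElem? (i := i) (lt_of_lt_of_le (by omega : i < n + i + 1) (hlenS _ _))
      have h4 := (hfS β (n + i + 1)).getElem? (i := i) (lt_of_lt_of_le (by omega : i < n + i + 1) (hlenS _ _))
      rw [h1, List.getElem?_append_right hi] at h3
      rw [h2, List.getElem?_append_right (by rw [hlenEq β α]; exact hi), hlenEq β α, h3] at h4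
      exact Option.some.inj h4
    · intro hEab
      by_contra hcon
      simp only [E₀, not_exists, not_forall] at hcon
      refine hDE (mem_iInter.2 fun n => ?_ : ((⟨f α, (hp _).2 (hf α)⟩ : {x // p x}),
        (⟨f β, (hp _).2 (hf β)⟩ : {x // p x})) ∈ _) hEab
      -- A disagreement at some `m ≥ n` puts the pair into `D m ⊆ D n`. Disagreements at arbitrarily
      -- large indices thus put it into every `D n`, which excludes `E`.
      obtain ⟨m, hnm, hm⟩ := hcon n
      refine hDa hnm (hsub m (Z m) (S α m) (hSZ α m) (S β m) (hSZ β m) (α m) ⟨?_, ?_⟩)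
      · exact hfS α (m + 1)
      · have : (!(α m)) = β m := by
          revert hm
          cases α m <;> cases β m <;> simp
        rw [this]
        exact hfS β (m + 1)

theorem polishSpace_blockSeq [TopologicalSpace Q] [DiscreteTopology Q] [Countable Q]
    (hp : ∀ x, p x ↔ IsBlockSeq lo hi x) : PolishSpace {x // p x} := by
  have hcl : IsClosed {x | p x} := by
    have : {x | p x} = ⋂ n, {x : ℕ → Q | hi (x n) < lo (x (n + 1))} := by
      ext x
      simp [hp, IsBlockSeq]
    rw [this]
    refine isClosed_iInter fun n => ?_
    have hc : Continuous fun x : ℕ → Q => (x n, x (n + 1)) := by fun_prop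
    exact (isClosed_discrete {z : Q × Q | hi z.1 < lo z.2}).preimage hc
  obtain ⟨f, hf⟩ := exists_injective_nat Q
  have : PolishSpace Q :=
    (IsClosedEmbedding.of_continuous_injective_isClosedMap continuous_of_discreteTopology hf
      fun s _ => isClosed_discrete _).polishSpace
  exact hcl.polishSpace

/-- An analytic equivalence relation on block sequences that contains eventual equality has a
comeagre class, unless `E₀` reduces continuously to it. -/
theorem exists_reduction_or_residual [TopologicalSpace Q] [DiscreteTopology Q] [Countable Q]
    (hlh : ∀ q, lo q ≤ hi q) (hex : ∀ n, ∃ q, n ≤ lo q) (hp : ∀ x, p x ↔ IsBlockSeq lo hi x)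
    {E : {x // p x} → {x // p x} → Prop} (hEq : Equivalence E)
    (htail : ∀ x y : {x // p x}, (∃ L, ∀ n, L ≤ n → x.1 n = y.1 n) → E x y)
    (hE : MeasureTheory.AnalyticSet {z : {x // p x} × {x // p x} | E z.1 z.2}) :
    (∃ f : (ℕ → Bool) → {x // p x}, Continuous f ∧ ∀ α β, E₀ α β ↔ E (f α) (f β)) ∨
      ∃ a, {b | E a b} ∈ residual {x // p x} := by
  have : PolishSpace {x // p x} := polishSpace_blockSeq hp
  rcases AnalyticSet.isMeagre_or_exists_isOpen hE with h | ⟨W, hW, ⟨⟨x, y⟩, hxy⟩, hm⟩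
  · exact Or.inl (exists_continuous_reduction hlh hex hp htail h)
  right
  obtain ⟨U, V, hU, hV, hxU, hyV, hUV⟩ := isOpen_prod_iff.1 hW x y hxy
  -- Almost every vertical section of the meagre set `W \ E` is meagre, so for some `a ∈ U` the
  -- class of `a` is comeagre in `V`.
  obtain ⟨a, ha, haU⟩ := (dense_of_mem_residual (IsMeagre.eventually_section hm)).inter_open_nonempty
    U hU ⟨x, hxU⟩
  obtain ⟨n, hn⟩ := exists_initial_subset hV hyV
  have hbl := IsBlockSeq.blockList hlh ((hp _).1 y.2) 0 n
  simp only [zero_add] at hbl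
  refine ⟨a, mem_residual_of_isMeagre_cyl_diff hlh hex hp
    (fun z w hzw hz => hEq.trans hz (htail z w hzw)) hbl (haU.mono ?_)⟩
  rintro z ⟨hz, hza⟩
  refine ⟨hUV ⟨ha, hn z fun i hi => ?_⟩, hza⟩
  have hz : IsInitial _ z.1 := hz
  rw [IsInitial, length_initial] at hz
  exact eq_of_initial_eq hz hi

end Dichotomy

/-! ### Inserting half of a given block sequence into a generic one. -/

section Generic

variable {Q : Type*} {lo hi : Q → ℕ} {p : (ℕ → Q) → Prop}

/-- The supports `[lo a, hi a]` and `[lo b, hi b]` are disjoint. -/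
def Apart (lo hi : Q → ℕ) (a b : Q) : Prop := hi a < lo b ∨ hi b < lo a

/-- Two block lists `u`, `x` supported before `y n`, where `x` consists of the terms of `u` and of
the terms of `y` with index in `K`. -/
structure Interleaved (lo hi : Q → ℕ) (y : ℕ → Q) (n : ℕ) (u x : List Q) (K : Set ℕ) : Prop where
  left : BlockList lo hi 0 (lo (y n)) u
  right : BlockList lo hi 0 (lo (y n)) x
  subset : K ⊆ Iio n
  mem_iff : ∀ q, q ∈ x ↔ q ∈ u ∨ q ∈ y '' K
  apart : ∀ q ∈ u, ∀ j ∈ K, Apart lo hi q (y j)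

theorem IsBlockSeq.lo_monotone (hlh : ∀ q, lo q ≤ hi q) {y : ℕ → Q} (hy : IsBlockSeq lo hi y) :
    Monotone fun n => lo (y n) :=
  monotone_nat_of_le_succ fun n => (hlh _).trans (hy n).le

theorem IsBlockSeq.le_lo (hlh : ∀ q, lo q ≤ hi q) {y : ℕ → Q} (hy : IsBlockSeq lo hi y) (n : ℕ) :
    n ≤ lo (y n) := by
  induction n with
  | zero => exact Nat.zero_le _
  | succ n ih =>
    have := hy n
    have := hlh (y n)
    omega

/-- The same continuation is appended to both lists, so they still differ only by terms of `y`. It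
is found in two stages, bringing first `u` and then `x` into `D`; the second stage does not spoil
the first. Terms of `y` overlapping the continuation are skipped by moving on to `n'`. -/
theorem Interleaved.extend_dense [TopologicalSpace Q] [DiscreteTopology Q]
    (hlh : ∀ q, lo q ≤ hi q) (hex : ∀ n, ∃ q, n ≤ lo q) (hp : ∀ x, p x ↔ IsBlockSeq lo hi x)
    {D : Set {x // p x}} (hD : IsOpen D) (hDd : Dense D) {y : ℕ → Q} (hy : IsBlockSeq lo hi y)
    {n : ℕ} {u x : List Q} {K : Set ℕ} (h : Interleaved lo hi y n u x K) :
    ∃ w n', n < n' ∧ w ≠ [] ∧ Interleaved lo hi y n' (u ++ w) (x ++ w) K ∧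
      cyl p (u ++ w) ⊆ D ∧ cyl p (x ++ w) ⊆ D := by
  obtain ⟨w, L, hw, hwb, hwD⟩ := exists_append_subset_dense hlh hex hp hD hDd h.left _ le_rfl
  have hxw : BlockList lo hi 0 (max L (lo (y n))) (x ++ w) :=
    h.right.append (hwb.mono le_rfl (le_max_left _ _)) (Nat.zero_le _) le_rfl (le_max_right _ _)
  obtain ⟨v, L', hv, hvb, hvD⟩ := exists_append_subset_dense hlh hex hp hD hDd hxw _ le_rfl
  let n' := max (max L L') (n + 1)
  have hn' : n' ≤ lo (y n') := hy.le_lo hlh n'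
  have hnn' : lo (y n) ≤ lo (y n') := hy.lo_monotone hlh (by omega)
  have hwv : BlockList lo hi (lo (y n)) (lo (y n')) (w ++ v) :=
    (hwb.mono le_rfl (le_max_left _ _)).append (hvb.mono le_rfl (by omega)) (le_max_right _ _)
      le_rfl (by omega)
  refine ⟨w ++ v, n', by omega, by simp [hw], ⟨?_, ?_, ?_, ?_, ?_⟩, ?_, ?_⟩
  · exact h.left.append hwv (Nat.zero_le _) le_rfl hnn'
  · exact h.right.append hwv (Nat.zero_le _) le_rfl hnn'
  · exact h.subset.trans (Iio_subset_Iio (by omega))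
  · intro q
    simp only [List.mem_append, h.mem_iff]
    tauto
  · intro q hq j hj
    rcases List.mem_append.1 hq with hq | hq
    · exact h.apart q hq j hj
    · exact Or.inr ((hy.lt hlh (h.subset hj)).trans_le (hwv.le_lo q hq))
  · rw [← List.append_assoc]
    exact (cyl_append_subset _ _).trans hwD
  · rw [← List.append_assoc]
    exact hvD

/-- All of `u` is supported before `y n`, so the terms of `y` from index `n` on can be added to `x`
alone and stay apart from `u`. -/
theorem Interleaved.extend_seq (hlh : ∀ q, lo q ≤ hi q) {y : ℕ → Q} (hy : IsBlockSeq lo hi y)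
    {n n' : ℕ} (hn : n ≤ n') {u x : List Q} {K : Set ℕ} (h : Interleaved lo hi y n u x K) :
    ∃ z, Interleaved lo hi y n' u (x ++ z) (K ∪ Ico n n') := by
  obtain ⟨k, rfl⟩ := Nat.exists_eq_add_of_le hn
  have hm : lo (y n) ≤ lo (y (n + k)) := hy.lo_monotone hlh hn
  refine ⟨initial (fun i => y (n + i)) k, h.left.mono le_rfl hm,
    h.right.append (hy.blockList hlh n k) (Nat.zero_le _) le_rfl hm, ?_, ?_, ?_⟩
  · exact union_subset (h.subset.trans (Iio_subset_Iio hn)) fun i hi => hi.2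
  · intro q
    rw [List.mem_append, h.mem_iff, mem_initial, image_union, mem_union, or_assoc]
    refine or_congr_right (or_congr_right ⟨?_, ?_⟩)
    · rintro ⟨i, hi, rfl⟩
      exact ⟨n + i, ⟨by omega, by omega⟩, rfl⟩
    · rintro ⟨i, ⟨h1, h2⟩, rfl⟩
      exact ⟨i - n, by omega, by congr 1; omega⟩
  · rintro q hq j (hj | hj)
    · exact h.apart q hq j hj
    · exact Or.inl ((h.left.hi_lt q hq).trans_le (hy.lo_monotone hlh hj.1))

/-- The indices of a block sequence `y` can be split into two sets such that, for each of them, some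
generic block sequence stays generic when it is enlarged by the terms of `y` with index in that
set. -/
theorem exists_generic_interleaved [TopologicalSpace Q] [DiscreteTopology Q]
    (hlh : ∀ q, lo q ≤ hi q) (hex : ∀ n, ∃ q, n ≤ lo q) (hp : ∀ x, p x ↔ IsBlockSeq lo hi x)
    {C : Set {x // p x}} (hC : C ∈ residual {x // p x}) {y : ℕ → Q} (hy : IsBlockSeq lo hi y) :
    ∃ J J' : Set ℕ, J ∪ J' = univ ∧ Disjoint J J' ∧ ∀ K ∈ ({J, J'} : Set (Set ℕ)),
      ∃ u ∈ C, ∃ x ∈ C, range x.1 = range u.1 ∪ y '' K ∧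
        ∀ i, ∀ j ∈ K, Apart lo hi (u.1 i) (y j) := by
  obtain ⟨D, -, hDo, hDd, hDC⟩ := exists_antitone_of_mem_residual hC
  let State := {z : ℕ × (List Q × List Q × Set ℕ) × (List Q × List Q × Set ℕ) //
    Interleaved lo hi y z.1 z.2.1.1 z.2.1.2.1 z.2.1.2.2 ∧
    Interleaved lo hi y z.1 z.2.2.1 z.2.2.2.1 z.2.2.2.2 ∧
    z.2.1.2.2 ∪ z.2.2.2.2 = Iio z.1 ∧ Disjoint z.2.1.2.2 z.2.2.2.2}
  have half : ∀ (k : ℕ) (n : ℕ) (u x : List Q) (K : Set ℕ), Interleaved lo hi y n u x K →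
      ∃ w n', n < n' ∧ w ≠ [] ∧ Interleaved lo hi y n' (u ++ w) (x ++ w) K ∧
      cyl p (u ++ w) ⊆ D k ∧ cyl p (x ++ w) ⊆ D k := fun k n u x K h =>
    h.extend_dense hlh hex hp (hDo k) (hDd k) hy
  have hstep : ∀ (k : ℕ) (z : State), ∃ z' : State, z.1.1 < z'.1.1 ∧
      (∃ w, w ≠ [] ∧ z'.1.2.1.1 = z.1.2.1.1 ++ w) ∧
      (∃ w, w ≠ [] ∧ z'.1.2.1.2.1 = z.1.2.1.2.1 ++ w) ∧
      z.1.2.1.2.2 ⊆ z'.1.2.1.2.2 ∧ cyl p z'.1.2.1.1 ⊆ D k ∧ cyl p z'.1.2.1.2.1 ⊆ D k ∧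
      (∃ w, w ≠ [] ∧ z'.1.2.2.1 = z.1.2.2.1 ++ w) ∧
      (∃ w, w ≠ [] ∧ z'.1.2.2.2.1 = z.1.2.2.2.1 ++ w) ∧
      z.1.2.2.2.2 ⊆ z'.1.2.2.2.2 ∧ cyl p z'.1.2.2.1 ⊆ D k ∧ cyl p z'.1.2.2.2.1 ⊆ D k := by
    rintro k ⟨⟨n, ⟨u, x, K⟩, ⟨u', x', K'⟩⟩, h, h', hU, hd⟩
    simp only at h h' hU hd ⊢
    -- The first pair moves generically past `y n, …, y (n1 - 1)`, and these terms are given to the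
    -- second pair. The second pair then moves generically up to `n2`, leaving the indices in `[n1,
    -- n2)` to the first. Each index therefore goes to exactly one pair.
    obtain ⟨w, n1, hn1, hw, h1, hD1, hD2⟩ := half k n u x K h
    obtain ⟨z', h1'⟩ := h'.extend_seq hlh hy hn1.le
    obtain ⟨w', n2, hn2, hw', h2', hD1', hD2'⟩ := half k n1 _ _ _ h1'
    obtain ⟨z, h2⟩ := h1.extend_seq hlh hy hn2.le
    refine ⟨⟨⟨n2, ⟨_, _, _⟩, ⟨_, _, _⟩⟩, h2, h2', ?_, ?_⟩, hn1.trans hn2, ⟨w, hw, rfl⟩,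
      ⟨w ++ z, by simp [hw], by simp⟩, subset_union_left, hD1, (cyl_append_subset _ _).trans hD2,
      ⟨w', hw', rfl⟩, ⟨z' ++ w', by simp [hw'], by simp⟩, subset_union_left, hD1', hD2'⟩
    · ext i
      have := congrArg (i ∈ ·) hU
      simp only [mem_union, mem_Iio, mem_Ico, eq_iff_iff] at this ⊢
      have a1 : i ∈ K → i < n := fun hi => h.subset hi
      have a2 : i ∈ K' → i < n := fun hi => h'.subset hi
      by_cases hi : i < n
      · have := this.2 hi
        constructor
        · omega
        · tauto
      · constructor
        · rintro ((h | h) | (h | h))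
          · have := a1 h; omega
          · omega
          · have := a2 h; omega
          · omega
        · intro h
          by_cases h3 : i < n1
          · right; right; omega
          · left; right; omega
    · rw [disjoint_left] at hd ⊢
      rintro i (hi | hi) (hi' | hi')
      · exact hd hi hi'
      · exact absurd (h.subset hi) (not_lt.2 hi'.1)
      · exact absurd (h'.subset hi') (not_lt.2 (hn1.le.trans hi.1))
      · exact absurd hi'.2 (not_lt.2 hi.1)
  choose next hnext using hstep
  let Z : ℕ → State := fun k => Nat.rec ⟨⟨0, ⟨[], [], ∅⟩, ⟨[], [], ∅⟩⟩,
    ⟨.nil _ _, .nil _ _, by simp, by simp, by simp⟩, ⟨.nil _ _, .nil _ _, by simp, by simp, by simp⟩,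
    by ext; simp, by simp⟩ next k
  have hZ : ∀ k, Z (k + 1) = next k (Z k) := fun k => rfl
  have hn : ∀ k, k ≤ (Z k).1.1 := by
    intro k
    induction k with
    | zero => exact Nat.zero_le _
    | succ k ih => have := (hnext k (Z k)).1; rw [hZ]; omega
  have hlim : ∀ (a : ℕ → List Q × List Q × Set ℕ),
      (∀ k, Interleaved lo hi y (Z k).1.1 (a k).1 (a k).2.1 (a k).2.2) →
      (∀ k, (∃ w, w ≠ [] ∧ (a (k + 1)).1 = (a k).1 ++ w) ∧
        (∃ w, w ≠ [] ∧ (a (k + 1)).2.1 = (a k).2.1 ++ w) ∧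
        (a k).2.2 ⊆ (a (k + 1)).2.2 ∧ cyl p (a (k + 1)).1 ⊆ D k ∧ cyl p (a (k + 1)).2.1 ⊆ D k) →
      ∃ u ∈ C, ∃ x ∈ C, range x.1 = range u.1 ∪ y '' (⋃ k, (a k).2.2) ∧
        ∀ i, ∀ j ∈ ⋃ k, (a k).2.2, Apart lo hi (u.1 i) (y j) := by
    intro a ha hs
    obtain ⟨u, hu, hu', hur⟩ := exists_limit_isBlockSeq (lo := lo) (hi := hi) (fun k => (a k).1)
      (fun k => (hs k).1) fun k => (ha k).left.isChain
    obtain ⟨x, hx, hx', hxr⟩ := exists_limit_isBlockSeq (lo := lo) (hi := hi) (fun k => (a k).2.1)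
      (fun k => (hs k).2.1) fun k => (ha k).right.isChain
    refine ⟨⟨u, (hp u).2 hu⟩, hDC (mem_iInter.2 fun k => (hs k).2.2.2.1 (hu' (k + 1))),
      ⟨x, (hp x).2 hx⟩, hDC (mem_iInter.2 fun k => (hs k).2.2.2.2 (hx' (k + 1))), ?_, ?_⟩
    · simp only [hur, hxr]
      ext q
      simp only [mem_union, image_iUnion, mem_iUnion, mem_ofPred_eq, (ha _).mem_iff, exists_or]
    · intro i j hj
      have hmono : Monotone fun k => (a k).2.2 := monotone_nat_of_le_succ fun k => (hs k).2.2.1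
      have hmono' : ∀ k l, k ≤ l → ∀ q ∈ (a k).1, q ∈ (a l).1 := by
        intro k l hkl q hq
        induction l, hkl using Nat.le_induction with
        | base => exact hq
        | succ l _ ih =>
          obtain ⟨w, -, hw⟩ := (hs l).1
          rw [hw]
          exact List.mem_append_left _ ih
      obtain ⟨k, hk⟩ := mem_iUnion.1 hj
      obtain ⟨l, hl⟩ : u i ∈ {q | ∃ k, q ∈ (a k).1} := hur ▸ mem_range_self i
      exact (ha (max k l)).apart _ (hmono' l _ (le_max_right _ _) _ hl) j
        (hmono (le_max_left _ _) hk)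
  refine ⟨⋃ k, (Z k).1.2.1.2.2, ⋃ k, (Z k).1.2.2.2.2, ?_, ?_, ?_⟩
  · rw [← iUnion_union_distrib, eq_univ_iff_forall]
    intro i
    refine mem_iUnion.2 ⟨i + 1, ?_⟩
    rw [(Z (i + 1)).2.2.2.1]
    exact hn (i + 1)
  · have hm1 : Monotone fun k => (Z k).1.2.1.2.2 :=
      monotone_nat_of_le_succ fun k => (hnext k (Z k)).2.2.2.1
    have hm2 : Monotone fun k => (Z k).1.2.2.2.2 :=
      monotone_nat_of_le_succ fun k => (hnext k (Z k)).2.2.2.2.2.2.2.2.1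
    rw [disjoint_left]
    intro i hi hi'
    obtain ⟨k, hk⟩ := mem_iUnion.1 hi
    obtain ⟨l, hl⟩ := mem_iUnion.1 hi'
    exact disjoint_left.1 (Z (max k l)).2.2.2.2 (hm1 (le_max_left _ _) hk)
      (hm2 (le_max_right _ _) hl)
  · rintro K (rfl | rfl)
    · refine hlim (fun k => (Z k).1.2.1) (fun k => (Z k).2.1) fun k => ?_
      obtain ⟨-, h1, h2, h3, h4, h5, -⟩ := hnext k (Z k)
      exact ⟨h1, h2, h3, h4, h5⟩
    · refine hlim (fun k => (Z k).1.2.2) (fun k => (Z k).2.2.1) fun k => ?_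
      obtain ⟨-, -, -, -, -, -, h1, h2, h3, h4, h5⟩ := hnext k (Z k)
      exact ⟨h1, h2, h3, h4, h5⟩

end Generic

/-! ### Closed spans, direct sums and small perturbations. -/

section Spans

variable {𝕜 X : Type*} [RCLike 𝕜] [NormedAddCommGroup X] [NormedSpace 𝕜 X]

variable (𝕜) in
/-- The closed linear span of a set. -/
def cspan (A : Set X) : Submodule 𝕜 X := (Submodule.span 𝕜 A).topologicalClosure

theorem closedSpan_eq_cspan (y : ℕ → X) : closedSpan 𝕜 y = cspan 𝕜 (range y) := rfl

theorem isClosed_cspan (A : Set X) : IsClosed (cspan 𝕜 A : Set X) :=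
  Submodule.isClosed_topologicalClosure _

theorem subset_cspan (A : Set X) : A ⊆ cspan 𝕜 A :=
  Submodule.subset_span.trans (Submodule.le_topologicalClosure _)

theorem cspan_le {A : Set X} {F : Submodule 𝕜 X} (hF : IsClosed (F : Set X)) (h : A ⊆ F) :
    cspan 𝕜 A ≤ F :=
  Submodule.topologicalClosure_minimal _ (Submodule.span_le.2 h) hF

theorem cspan_mono {A B : Set X} (h : A ⊆ B) : cspan 𝕜 A ≤ cspan 𝕜 B :=
  cspan_le (isClosed_cspan B) (h.trans (subset_cspan B))

theorem map_mem_cspan {A B : Set X} {f : X →L[𝕜] X} (h : ∀ a ∈ A, f a ∈ cspan 𝕜 B) {x : X}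
    (hx : x ∈ cspan 𝕜 A) : f x ∈ cspan 𝕜 B :=
  (cspan_le (F := (cspan 𝕜 B).comap f.toLinearMap) ((isClosed_cspan B).preimage f.continuous) h) hx

theorem eqOn_cspan {Y : Type*} [NormedAddCommGroup Y] [NormedSpace 𝕜 Y] {A : Set X}
    {f g : X →L[𝕜] Y} (h : ∀ a ∈ A, f a = g a) {x : X} (hx : x ∈ cspan 𝕜 A) : f x = g x :=
  (cspan_le (F := LinearMap.eqLocus f.toLinearMap g.toLinearMap)
    (isClosed_eq f.continuous g.continuous) h) hx

theorem nonempty_cspan_equiv {A B : Set X} (f g : X →L[𝕜] X) (hf : ∀ a ∈ A, f a ∈ cspan 𝕜 B)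
    (hg : ∀ b ∈ B, g b ∈ cspan 𝕜 A) (hgf : ∀ a ∈ A, g (f a) = a) (hfg : ∀ b ∈ B, f (g b) = b) :
    Nonempty (cspan 𝕜 A ≃L[𝕜] cspan 𝕜 B) :=
  ⟨ContinuousLinearEquiv.equivOfInverse
    ((f.comp (cspan 𝕜 A).subtypeL).codRestrict (cspan 𝕜 B) fun x => map_mem_cspan hf x.2)
    ((g.comp (cspan 𝕜 B).subtypeL).codRestrict (cspan 𝕜 A) fun x => map_mem_cspan hg x.2)
    (fun x => Subtype.ext (eqOn_cspan (f := g.comp f) (g := .id 𝕜 X) hgf x.2))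
    (fun x => Subtype.ext (eqOn_cspan (f := f.comp g) (g := .id 𝕜 X) hfg x.2))⟩

/-- The isomorphism is `x ↦ (P x, x - P x)`, with addition as inverse. Only the values of `P` on `A`
and `B` matter, by density. -/
theorem nonempty_cspan_equiv_prod {A B : Set X} (P : X →L[𝕜] X) (hA : ∀ a ∈ A, P a = a)
    (hB : ∀ b ∈ B, P b = 0) :
    Nonempty (cspan 𝕜 (A ∪ B) ≃L[𝕜] (cspan 𝕜 A × cspan 𝕜 B)) := by
  have h1 : ∀ a ∈ A ∪ B, P a ∈ cspan 𝕜 A := by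
    rintro a (ha | ha)
    · rw [hA a ha]; exact subset_cspan A ha
    · rw [hB a ha]; exact zero_mem _
  have h2 : ∀ a ∈ A ∪ B, (ContinuousLinearMap.id 𝕜 X - P) a ∈ cspan 𝕜 B := by
    rintro a (ha | ha)
    · simp [hA a ha]
    · simpa [hB a ha] using subset_cspan B ha
  have hA' : ∀ x ∈ cspan 𝕜 A, P x = x := fun x hx =>
    eqOn_cspan (f := P) (g := .id 𝕜 X) hA hx
  have hB' : ∀ x ∈ cspan 𝕜 B, P x = 0 := fun x hx =>
    eqOn_cspan (f := P) (g := 0) hB hx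
  refine ⟨ContinuousLinearEquiv.equivOfInverse
    (((P.comp (cspan 𝕜 (A ∪ B)).subtypeL).codRestrict (cspan 𝕜 A)
      fun x => map_mem_cspan h1 x.2).prod
      (((ContinuousLinearMap.id 𝕜 X - P).comp (cspan 𝕜 (A ∪ B)).subtypeL).codRestrict (cspan 𝕜 B)
        fun x => map_mem_cspan h2 x.2))
    (((cspan 𝕜 A).subtypeL.coprod (cspan 𝕜 B).subtypeL).codRestrict (cspan 𝕜 (A ∪ B)) fun x =>
      add_mem (cspan_mono subset_union_left x.1.2) (cspan_mono subset_union_right x.2.2)) ?_ ?_⟩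
  · intro x
    apply Subtype.ext
    show P x + (x - P x) = (x : X)
    abel
  · rintro ⟨x, y⟩
    refine Prod.ext (Subtype.ext ?_) (Subtype.ext ?_)
    · show P (x + y) = (x : X)
      rw [map_add, hA' _ x.2, hB' _ y.2, add_zero]
    · show (x + y : X) - P (x + y) = (y : X)
      rw [map_add, hA' _ x.2, hB' _ y.2, add_zero, add_sub_cancel_left]

/-- Small perturbations: if `ψ` is biorthogonal to `w` and `w'` is close enough to `w`, then some
automorphism of the space takes `w` to `w'`. -/
theorem exists_automorphism [CompleteSpace X] {w w' : ℕ → X} {ψ : ℕ → X →L[𝕜] 𝕜}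
    (hψ : ∀ i j, ψ i (w j) = if i = j then 1 else 0)
    (h : ∀ j, ‖ψ j‖ * ‖w' j - w j‖ ≤ (1 / 4) * (1 / 2) ^ j) :
    ∃ S : X ≃L[𝕜] X, ∀ j, S (w j) = w' j := by
  let R : ℕ → X →L[𝕜] X := fun j => (ψ j).smulRight (w' j - w j)
  have hg : HasSum (fun j : ℕ => (1 / 4 : ℝ) * (1 / 2) ^ j) (1 / 2) := by
    have := (hasSum_geometric_of_lt_one (r := (1 / 2 : ℝ)) (by norm_num) (by norm_num)).mul_left
      (1 / 4)
    rwa [show (1 / 4 : ℝ) * (1 - 1 / 2)⁻¹ = 1 / 2 by norm_num] at this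
  have hR : ∀ j, ‖R j‖ ≤ (1 / 4) * (1 / 2) ^ j := fun j => by
    rw [ContinuousLinearMap.norm_smulRight_apply]; exact h j
  have hs : Summable R := Summable.of_norm_bounded hg.summable hR
  have hn : ‖-∑' j, R j‖ < 1 := by
    rw [norm_neg]
    refine (tsum_of_norm_bounded hg hR).trans_lt (by norm_num)
  -- This is `1 + ∑ R j`, invertible by the Neumann series because the sum has norm at most `1 / 2`.
  let U : (X →L[𝕜] X)ˣ := Units.oneSub (-∑' j, R j) hn
  refine ⟨ContinuousLinearEquiv.unitsEquiv 𝕜 X U, fun l => ?_⟩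
  have h1 : (∑' j, R j) (w l) = w' l - w l := by
    have h2 : HasSum (fun j => R j (w l)) ((∑' j, R j) (w l)) :=
      hs.hasSum.mapL (ContinuousLinearMap.apply 𝕜 X (w l))
    rw [← h2.tsum_eq, tsum_eq_single l]
    · simp [R, hψ]
    · intro j hj
      simp [R, hψ, hj]
  have h3 : (ContinuousLinearEquiv.unitsEquiv 𝕜 X U) (w l) = w l - (-∑' j, R j) (w l) := rfl
  rw [h3, neg_apply, h1]
  abel

end Spans

/-! ### Biorthogonal functionals and projections of block bases. -/

section BlockBases

variable {𝕜 X : Type*} [RCLike 𝕜] [NormedAddCommGroup X] [NormedSpace 𝕜 X]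

theorem IsBlockBasis.trans {e y z : ℕ → X} (hy : IsBlockBasis 𝕜 e y) (hz : IsBlockBasis 𝕜 y z) :
    IsBlockBasis 𝕜 e z := by
  obtain ⟨-, p, hp, hpy⟩ := hy
  obtain ⟨hz0, q, hq, hqz⟩ := hz
  refine ⟨hz0, p ∘ q, hp.comp hq, fun n => ?_⟩
  refine (Submodule.span_le.2 ?_ : Submodule.span 𝕜 (y '' Ico (q n) (q (n + 1))) ≤ _) (hqz n)
  rintro _ ⟨i, hi, rfl⟩
  refine Submodule.span_mono (image_mono ?_) (hpy i)
  exact Ico_subset_Ico (hp.monotone hi.1) (hp.monotone hi.2)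

theorem IsBlockBasis.refl {e : ℕ → X} (he : ∀ n, e n ≠ 0) : IsBlockBasis 𝕜 e e :=
  ⟨he, id, strictMono_id, fun n => Submodule.subset_span ⟨n, ⟨le_rfl, Nat.lt_succ_self n⟩, rfl⟩⟩

theorem basis_ne_zero {L : SummationFilter ℕ} (e : GeneralSchauderBasis ℕ 𝕜 X L) (n : ℕ) :
    e n ≠ 0 := fun h => by
  have := e.ortho n n
  simp [h] at this

theorem coord_eq_zero {L : SummationFilter ℕ} (e : GeneralSchauderBasis ℕ 𝕜 X L) {S : Set ℕ}
    {k : ℕ} (hk : k ∉ S) {z : X} (hz : z ∈ Submodule.span 𝕜 (e '' S)) : e.coord k z = 0 := by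
  refine (Submodule.span_le.2 ?_ : Submodule.span 𝕜 (e '' S) ≤
    LinearMap.ker (e.coord k).toLinearMap) hz
  rintro _ ⟨i, hi, rfl⟩
  have : k ≠ i := fun h => hk (h ▸ hi)
  simp [e.ortho, this]

theorem exists_coord_ne_zero (e : UnconditionalSchauderBasis ℕ 𝕜 X) {z : X} (hz : z ≠ 0) :
    ∃ k, e.coord k z ≠ 0 := by
  by_contra! h
  refine hz ((e.expansion z).unique ?_)
  simp [h]

/-- A block basis has biorthogonal functionals. -/
theorem IsBlockBasis.exists_biorthogonal (e : UnconditionalSchauderBasis ℕ 𝕜 X) {y : ℕ → X}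
    (hy : IsBlockBasis 𝕜 e y) :
    ∃ ψ : ℕ → X →L[𝕜] 𝕜, ∀ i j, ψ i (y j) = if i = j then 1 else 0 := by
  obtain ⟨h0, p, hp, hpy⟩ := hy
  choose k hk using fun n => exists_coord_ne_zero e (h0 n)
  have hkp : ∀ n, k n ∈ Ico (p n) (p (n + 1)) := fun n => by
    by_contra h
    exact hk n (coord_eq_zero e h (hpy n))
  refine ⟨fun n => (e.coord (k n) (y n))⁻¹ • e.coord (k n), fun i j => ?_⟩
  by_cases hij : i = j
  · subst hij
    simp [hk]
  · simp only [hij, if_false]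
    have : k i ∉ Ico (p j) (p (j + 1)) := by
      intro h
      rcases lt_or_gt_of_ne hij with h' | h'
      · have := hp.monotone (show i + 1 ≤ j from h')
        have := (hkp i).2
        have := h.1
        omega
      · have := hp.monotone (show j + 1 ≤ i from h')
        have := (hkp i).1
        have := h.2
        omega
    simp [coord_eq_zero e this (hpy j)]

theorem linearIndependent_of_biorthogonal {y : ℕ → X} {ψ : ℕ → X →L[𝕜] 𝕜}
    (hψ : ∀ i j, ψ i (y j) = if i = j then 1 else 0) : LinearIndependent 𝕜 y := by
  refine linearIndependent_iff.mpr fun l hl => l.ext fun i => ?_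
  have := congrArg (ψ i) hl
  simpa [l.linearCombination_apply, Finsupp.sum, hψ] using this

/-- Unconditionality makes every subseries of the expansion converge; the pointwise limit of the
partial sums is a bounded operator by Banach–Steinhaus. -/
theorem exists_basis_projection [CompleteSpace X] (e : UnconditionalSchauderBasis ℕ 𝕜 X)
    (S : Set ℕ) : ∃ P : X →L[𝕜] X, (∀ i ∈ S, P (e i) = e i) ∧ ∀ i ∉ S, P (e i) = 0 := by
  classical
  have hs : ∀ x, Summable (S.indicator fun i => e.coord i x • e i) := fun x =>
    (e.expansion x).summable.indicator S
  have ht : Filter.Tendsto (fun n x => e.proj ((Finset.range n).filter (· ∈ S)) x) Filter.atTop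
      (𝓝 fun x => ∑' i, S.indicator (fun i => e.coord i x • e i) i) := by
    rw [tendsto_pi_nhds]
    intro x
    refine ((hs x).hasSum.tendsto_sum_nat).congr fun n => ?_
    rw [GeneralSchauderBasis.proj_apply, Finset.sum_filter]
    rfl
  refine ⟨continuousLinearMapOfTendsto _ ht, fun i hi => ?_, fun i hi => ?_⟩
  · show ∑' j, S.indicator (fun j => e.coord j (e i) • e j) j = e i
    rw [tsum_eq_single i]
    · simp [hi, e.ortho]
    · intro j hj
      simp [e.ortho, hj, Set.indicator]
  · show ∑' j, S.indicator (fun j => e.coord j (e i) • e j) j = 0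
    rw [tsum_eq_single i]
    · simp [hi]
    · intro j hj
      simp [e.ortho, hj, Set.indicator]

/-- The projections associated with subsets of a block basis. -/
theorem IsBlockBasis.exists_projection [CompleteSpace X] (e : UnconditionalSchauderBasis ℕ 𝕜 X)
    {y : ℕ → X} (hy : IsBlockBasis 𝕜 e y) (S : Set ℕ) :
    ∃ P : X →L[𝕜] X, (∀ i ∈ S, P (y i) = y i) ∧ ∀ i ∉ S, P (y i) = 0 := by
  obtain ⟨h0, p, hp, hpy⟩ := hy
  obtain ⟨P, hP, hP'⟩ := exists_basis_projection e (⋃ i ∈ S, Ico (p i) (p (i + 1)))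
  refine ⟨P, fun i hi => ?_, fun i hi => ?_⟩
  · refine (Submodule.span_le.2 ?_ : Submodule.span 𝕜 (e '' Ico (p i) (p (i + 1))) ≤
      LinearMap.eqLocus P.toLinearMap LinearMap.id) (hpy i)
    rintro _ ⟨j, hj, rfl⟩
    exact hP j (mem_biUnion hi hj)
  · refine (Submodule.span_le.2 ?_ : Submodule.span 𝕜 (e '' Ico (p i) (p (i + 1))) ≤
      LinearMap.ker P.toLinearMap) (hpy i)
    rintro _ ⟨j, hj, rfl⟩
    refine hP' j fun h => ?_
    obtain ⟨l, hl, hjl⟩ := mem_iUnion₂.1 h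
    have hli : l ≠ i := fun h => hi (h ▸ hl)
    rcases lt_or_gt_of_ne hli with h' | h'
    · have := hp.monotone (show l + 1 ≤ i from h')
      have := hjl.2
      have := hj.1
      omega
    · have := hp.monotone (show i + 1 ≤ l from h')
      have := hjl.1
      have := hj.2
      omega

theorem cspan_eq_span_of_finite {A : Set X} (hA : A.Finite) :
    cspan 𝕜 A = Submodule.span 𝕜 A := by
  have := FiniteDimensional.span_of_finite 𝕜 hA
  exact (Submodule.closed_of_finiteDimensional _).submodule_topologicalClosure_eq

/-- Changing finitely many terms of a block basis does not change the isomorphism class of its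
closed span. -/
theorem nonempty_equiv_of_eventually_eq [CompleteSpace X] (e : UnconditionalSchauderBasis ℕ 𝕜 X)
    {y z : ℕ → X} (hy : IsBlockBasis 𝕜 e y) (hz : IsBlockBasis 𝕜 e z) {L : ℕ}
    (h : ∀ n, L ≤ n → y n = z n) : Nonempty (closedSpan 𝕜 y ≃L[𝕜] closedSpan 𝕜 z) := by
  -- The first `L` terms are split off. The heads of `y` and `z` both have dimension `L`, and the
  -- tails coincide.
  have key : ∀ x : ℕ → X, IsBlockBasis 𝕜 e x → Nonempty (closedSpan 𝕜 x ≃L[𝕜]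
      (cspan 𝕜 (x '' Iio L) × cspan 𝕜 (x '' Ici L))) := by
    intro x hx
    obtain ⟨P, hP, hP'⟩ := hx.exists_projection e (Iio L)
    have hr : range x = x '' Iio L ∪ x '' Ici L := by
      rw [← image_union, Iio_union_Ici, image_univ]
    rw [closedSpan_eq_cspan, hr]
    refine nonempty_cspan_equiv_prod P ?_ ?_
    · rintro _ ⟨i, hi, rfl⟩
      exact hP i hi
    · rintro _ ⟨i, hi, rfl⟩
      exact hP' i (by simpa using hi)
  have hdim : ∀ x : ℕ → X, IsBlockBasis 𝕜 e x →
      FiniteDimensional 𝕜 (cspan 𝕜 (x '' Iio L)) ∧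
        Module.finrank 𝕜 (cspan 𝕜 (x '' Iio L)) = L := by
    intro x hx
    obtain ⟨ψ, hψ⟩ := hx.exists_biorthogonal e
    have hli := linearIndependent_of_biorthogonal hψ
    have hfin : (x '' Iio L).Finite := (finite_Iio L).image x
    rw [cspan_eq_span_of_finite hfin]
    refine ⟨FiniteDimensional.span_of_finite 𝕜 hfin, ?_⟩
    have := finrank_span_eq_card (hli.comp ((↑) : Iio L → ℕ) Subtype.val_injective)
    rw [range_comp, Subtype.range_coe] at this
    simpa using this
  obtain ⟨Ty⟩ := key y hy
  obtain ⟨Tz⟩ := key z hz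
  obtain ⟨hfy, hdy⟩ := hdim y hy
  obtain ⟨hfz, hdz⟩ := hdim z hz
  have hyz : y '' Ici L = z '' Ici L := image_congr fun n hn => h n hn
  rw [hyz] at Ty
  let T : cspan 𝕜 (y '' Iio L) ≃L[𝕜] cspan 𝕜 (z '' Iio L) :=
    ContinuousLinearEquiv.ofFinrankEq (hdy.trans hdz.symm)
  exact ⟨(Ty.trans (T.prodCongr (.refl 𝕜 _))).trans Tz.symm⟩

end BlockBases

/-! ### Analyticity of isomorphism and Borel dependence of closed spans. -/

section Analytic

variable {𝕜 X : Type*} [RCLike 𝕜] [NormedAddCommGroup X] [NormedSpace 𝕜 X]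

variable (𝕜) in
/-- Finite linear combinations of a sequence, as elements of its closed span. -/
noncomputable def combination (a : ℕ → X) : (ℕ →₀ 𝕜) →ₗ[𝕜] closedSpan 𝕜 a :=
  (Finsupp.linearCombination 𝕜 a).codRestrict (closedSpan 𝕜 a) fun c =>
    Submodule.le_topologicalClosure _ (Finsupp.mem_span_range_iff_exists_finsupp.2 ⟨c, rfl⟩)

theorem mem_closedSpan_iff {a : ℕ → X} {x : X} :
    x ∈ closedSpan 𝕜 a ↔ ∀ n : ℕ, ∃ c : ℕ →₀ 𝕜,
      ‖x - Finsupp.linearCombination 𝕜 a c‖ < 1 / ((n : ℝ) + 1) := by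
  rw [closedSpan, ← SetLike.mem_coe, Submodule.topologicalClosure_coe, Metric.mem_closure_iff]
  simp only [SetLike.mem_coe, Finsupp.mem_span_range_iff_exists_finsupp, dist_eq_norm]
  constructor
  · intro h n
    obtain ⟨b, ⟨c, rfl⟩, hb⟩ := h (1 / ((n : ℝ) + 1)) (by positivity)
    exact ⟨c, hb⟩
  · intro h ε hε
    obtain ⟨n, hn⟩ := exists_nat_one_div_lt hε
    obtain ⟨c, hc⟩ := h n
    exact ⟨_, ⟨c, rfl⟩, hc.trans hn⟩

theorem denseRange_combination (a : ℕ → X) : DenseRange (combination 𝕜 a) := by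
  intro x
  rw [Metric.mem_closure_iff]
  intro ε hε
  obtain ⟨n, hn⟩ := exists_nat_one_div_lt hε
  obtain ⟨c, hc⟩ := mem_closedSpan_iff.1 x.2 n
  exact ⟨_, ⟨c, rfl⟩, by rw [Subtype.dist_eq, dist_eq_norm]; exact hc.trans hn⟩

theorem exists_extension_of_norm_le [CompleteSpace X] {a x : ℕ → X} {K : ℝ}
    (h : ∀ c : ℕ →₀ 𝕜, ‖Finsupp.linearCombination 𝕜 x c‖ ≤
      K * ‖Finsupp.linearCombination 𝕜 a c‖) :
    ∃ f : closedSpan 𝕜 a →L[𝕜] closedSpan 𝕜 x,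
      ∀ c, f (combination 𝕜 a c) = combination 𝕜 x c := by
  have : CompleteSpace (closedSpan 𝕜 x) :=
    (Submodule.isClosed_topologicalClosure _).completeSpace_coe
  have hnorm : ∀ c, ‖combination 𝕜 x c‖ ≤ K * ‖combination 𝕜 a c‖ := h
  exact ⟨_, LinearMap.extendOfNorm_eq (denseRange_combination a) ⟨K, hnorm⟩⟩

/-- Equivalent sequences have isomorphic closed spans. -/
theorem exists_equiv_of_norm_le [CompleteSpace X] {a x : ℕ → X} {K : ℝ}
    (h1 : ∀ c : ℕ →₀ 𝕜, ‖Finsupp.linearCombination 𝕜 x c‖ ≤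
      K * ‖Finsupp.linearCombination 𝕜 a c‖)
    (h2 : ∀ c : ℕ →₀ 𝕜, ‖Finsupp.linearCombination 𝕜 a c‖ ≤
      K * ‖Finsupp.linearCombination 𝕜 x c‖) :
    Nonempty (closedSpan 𝕜 a ≃L[𝕜] closedSpan 𝕜 x) := by
  obtain ⟨f, hf⟩ := exists_extension_of_norm_le h1
  obtain ⟨g, hg⟩ := exists_extension_of_norm_le h2
  refine ⟨ContinuousLinearEquiv.equivOfInverse f g ?_ ?_⟩
  · exact congrFun ((denseRange_combination a).equalizer (g.continuous.comp f.continuous)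
      continuous_id (funext fun c => by simp [hf, hg]))
  · exact congrFun ((denseRange_combination x).equalizer (f.continuous.comp g.continuous)
      continuous_id (funext fun c => by simp [hf, hg]))

/-- An isomorphism takes a sequence to an equivalent one. -/
theorem exists_norm_le_of_equiv {F G : Submodule 𝕜 X} (T : F ≃L[𝕜] G) (b : ℕ → F) :
    ∃ K : ℕ, ∀ c : ℕ →₀ 𝕜,
      ‖Finsupp.linearCombination 𝕜 (fun n => (T (b n) : X)) c‖ ≤
        K * ‖Finsupp.linearCombination 𝕜 (fun n => (b n : X)) c‖ ∧
      ‖Finsupp.linearCombination 𝕜 (fun n => (b n : X)) c‖ ≤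
        K * ‖Finsupp.linearCombination 𝕜 (fun n => (T (b n) : X)) c‖ := by
  obtain ⟨K, hK⟩ := exists_nat_ge (max ‖(T : F →L[𝕜] G)‖ ‖(T.symm : G →L[𝕜] F)‖)
  refine ⟨K, fun c => ?_⟩
  have h1 : Finsupp.linearCombination 𝕜 (fun n => (b n : X)) c =
      (Finsupp.linearCombination 𝕜 b c : F) :=
    (Finsupp.apply_linearCombination 𝕜 F.subtype b c).symm
  have h2 : Finsupp.linearCombination 𝕜 (fun n => (T (b n) : X)) c =
      (T (Finsupp.linearCombination 𝕜 b c) : G) :=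
    (Finsupp.apply_linearCombination 𝕜 (G.subtype ∘ₗ T.toLinearEquiv.toLinearMap) b c).symm
  rw [h1, h2]
  constructor
  · exact ((T : F →L[𝕜] G).le_opNorm _).trans
      (mul_le_mul_of_nonneg_right ((le_max_left _ _).trans hK) (norm_nonneg _))
  · have := ((T.symm : G →L[𝕜] F).le_opNorm (T (Finsupp.linearCombination 𝕜 b c))).trans
      (mul_le_mul_of_nonneg_right ((le_max_right _ _).trans hK) (norm_nonneg _))
    simpa using this

/-- The quantifier over isomorphisms becomes one over an integer bound and the sequence `x` of
images of the terms of `a`. This exhibits the relation as a countable union of projections of sets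
defined by countably many approximations and closed inequalities. -/
theorem nonempty_equiv_iff_exists [CompleteSpace X] {a b : ℕ → X} :
    Nonempty (closedSpan 𝕜 a ≃L[𝕜] closedSpan 𝕜 b) ↔ ∃ (K : ℕ) (x : ℕ → X),
      (∀ c : ℕ →₀ 𝕜, ‖Finsupp.linearCombination 𝕜 x c‖ ≤
        K * ‖Finsupp.linearCombination 𝕜 a c‖) ∧
      (∀ c : ℕ →₀ 𝕜, ‖Finsupp.linearCombination 𝕜 a c‖ ≤
        K * ‖Finsupp.linearCombination 𝕜 x c‖) ∧
      (∀ n, x n ∈ closedSpan 𝕜 b) ∧ ∀ n, b n ∈ closedSpan 𝕜 x := by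
  constructor
  · rintro ⟨T⟩
    have hb : ∀ n, b n ∈ closedSpan 𝕜 b := fun n => subset_cspan _ (mem_range_self n)
    let a' : ℕ → closedSpan 𝕜 a := fun n => ⟨a n, subset_cspan _ (mem_range_self n)⟩
    obtain ⟨K, hK⟩ := exists_norm_le_of_equiv T a'
    refine ⟨K, fun n => T (a' n), fun c => (hK c).1, fun c => (hK c).2, fun n => (T (a' n)).2,
      fun n => ?_⟩
    have hcl : IsClosed {w : closedSpan 𝕜 a | (T w : X) ∈ closedSpan 𝕜 fun n => (T (a' n) : X)} :=
      (Submodule.isClosed_topologicalClosure _).preimage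
        (continuous_subtype_val.comp T.continuous)
    have := (denseRange_combination a).induction_on
      (p := fun w => (T w : X) ∈ closedSpan 𝕜 fun n => (T (a' n) : X)) (T.symm ⟨b n, hb n⟩) hcl
      fun c => by
        have h1 : combination 𝕜 a c = Finsupp.linearCombination 𝕜 a' c :=
          Subtype.ext (Finsupp.apply_linearCombination 𝕜 (closedSpan 𝕜 a).subtype a' c).symm
        have h2 : (T (combination 𝕜 a c) : X) =
            combination 𝕜 (fun n => (T (a' n) : X)) c := by
          rw [h1]
          exact Finsupp.apply_linearCombination 𝕜
            ((closedSpan 𝕜 b).subtype ∘ₗ T.toLinearEquiv.toLinearMap) a' c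
        rw [h2]
        exact (combination 𝕜 _ c).2
    simpa using this
  · rintro ⟨K, x, h1, h2, h3, h4⟩
    have : closedSpan 𝕜 x = closedSpan 𝕜 b := by
      refine le_antisymm (cspan_le (isClosed_cspan _) ?_) (cspan_le (isClosed_cspan _) ?_)
      · rintro _ ⟨n, rfl⟩
        exact h3 n
      · rintro _ ⟨n, rfl⟩
        exact h4 n
    rw [← this]
    exact exists_equiv_of_norm_le h1 h2

theorem continuous_linearCombination (c : ℕ →₀ 𝕜) :
    Continuous fun a : ℕ → X => Finsupp.linearCombination 𝕜 a c := by
  simp only [Finsupp.linearCombination_apply, Finsupp.sum]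
  fun_prop

theorem isGδ_mem_closedSpan {W : Type*} [TopologicalSpace W] {f : W → ℕ → X} (hf : Continuous f)
    {g : W → X} (hg : Continuous g) : IsGδ {w | g w ∈ closedSpan 𝕜 (f w)} := by
  simp only [mem_closedSpan_iff, ofPred_forall, ofPred_exists]
  refine IsGδ.iInter_of_isOpen fun n => isOpen_iUnion fun c => ?_
  exact isOpen_lt (hg.sub ((continuous_linearCombination c).comp hf)).norm continuous_const

/-- The relation of having isomorphic closed spans is analytic. -/
theorem analyticSet_nonempty_equiv [CompleteSpace X] [SecondCountableTopology X] {W : Type*}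
    [TopologicalSpace W] [PolishSpace W] {v : W → ℕ → X} (hv : Continuous v)
    {E : W → W → Prop}
    (hE : ∀ a b, E a b ↔ Nonempty (closedSpan 𝕜 (v a) ≃L[𝕜] closedSpan 𝕜 (v b))) :
    MeasureTheory.AnalyticSet {z : W × W | E z.1 z.2} := by
  let G : ℕ → Set ((W × W) × (ℕ → X)) := fun K => {z |
      (∀ c : ℕ →₀ 𝕜, ‖Finsupp.linearCombination 𝕜 z.2 c‖ ≤
        K * ‖Finsupp.linearCombination 𝕜 (v z.1.1) c‖) ∧
      (∀ c : ℕ →₀ 𝕜, ‖Finsupp.linearCombination 𝕜 (v z.1.1) c‖ ≤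
        K * ‖Finsupp.linearCombination 𝕜 z.2 c‖) ∧
      (∀ n, z.2 n ∈ closedSpan 𝕜 (v z.1.2)) ∧ ∀ n, v z.1.2 n ∈ closedSpan 𝕜 z.2}
  have h1 : Continuous fun z : (W × W) × (ℕ → X) => v z.1.1 := by fun_prop
  have h2 : Continuous fun z : (W × W) × (ℕ → X) => v z.1.2 := by fun_prop
  have hl1 : ∀ c : ℕ →₀ 𝕜, Continuous fun z : (W × W) × (ℕ → X) =>
      Finsupp.linearCombination 𝕜 (v z.1.1) c := fun c => (continuous_linearCombination c).comp h1
  have hl2 : ∀ c : ℕ →₀ 𝕜, Continuous fun z : (W × W) × (ℕ → X) =>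
      Finsupp.linearCombination 𝕜 z.2 c := fun c =>
    (continuous_linearCombination c).comp continuous_snd
  have hG : ∀ K, IsGδ (G K) := by
    intro K
    simp only [G, ofPred_and, ofPred_forall]
    -- Metrizability is needed for closed sets to be Gδ.
    let := TopologicalSpace.upgradeIsCompletelyMetrizable W
    refine IsGδ.inter (IsClosed.isGδ (isClosed_iInter fun c =>
      isClosed_le (hl2 c).norm (continuous_const.mul (hl1 c).norm))) (IsGδ.inter
      (IsClosed.isGδ (isClosed_iInter fun c =>
        isClosed_le (hl1 c).norm (continuous_const.mul (hl2 c).norm))) (IsGδ.inter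
      (IsGδ.iInter fun n => ?_) (IsGδ.iInter fun n => ?_)))
    · exact isGδ_mem_closedSpan h2 ((continuous_apply n).comp continuous_snd)
    · exact isGδ_mem_closedSpan continuous_snd ((continuous_apply n).comp h2)
  have hset : {z : W × W | E z.1 z.2} = ⋃ K, Prod.fst '' G K := by
    ext z
    simp only [mem_ofPred_eq, hE, nonempty_equiv_iff_exists, mem_iUnion]
    constructor
    · rintro ⟨K, x, h⟩
      exact ⟨K, (z, x), h, rfl⟩
    · rintro ⟨K, ⟨z, x⟩, h, rfl⟩
      exact ⟨K, x, h⟩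
  rw [hset]
  refine MeasureTheory.AnalyticSet.iUnion fun K => ?_
  let : MeasurableSpace ((W × W) × (ℕ → X)) := borel _
  have : BorelSpace ((W × W) × (ℕ → X)) := ⟨rfl⟩
  exact ((hG K).measurableSet.analyticSet).image_of_continuous continuous_fst

variable (𝕜) in
/-- The closed span as an element of the space of closed subspaces. -/
def closedSpanClosed (a : ℕ → X) : ClosedSubmodule 𝕜 X :=
  ⟨closedSpan 𝕜 a, Submodule.isClosed_topologicalClosure _⟩

theorem measurable_closedSpanClosed {W : Type*} [TopologicalSpace W] {v : W → ℕ → X}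
    (hv : Continuous v) :
    @Measurable _ _ (borel W) (effrosBorel 𝕜 X) fun w => closedSpanClosed 𝕜 (v w) := by
  let := borel W
  refine measurable_generateFrom ?_
  rintro _ ⟨U, hU, rfl⟩
  have : (fun w => closedSpanClosed 𝕜 (v w)) ⁻¹'
      {F : ClosedSubmodule 𝕜 X | ((F : Set X) ∩ U).Nonempty} =
      ⋃ c : ℕ →₀ 𝕜, {w | Finsupp.linearCombination 𝕜 (v w) c ∈ U} := by
    ext w
    simp only [mem_preimage, mem_ofPred_eq, mem_iUnion]
    constructor
    · rintro ⟨x, hx, hxU⟩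
      obtain ⟨_, hbU, ⟨c, rfl⟩⟩ := (denseRange_combination (𝕜 := 𝕜) (v w)).inter_open_nonempty
        _ (hU.preimage continuous_subtype_val) ⟨⟨x, hx⟩, hxU⟩
      exact ⟨c, hbU⟩
    · rintro ⟨c, hc⟩
      exact ⟨_, (combination 𝕜 (v w) c).2, hc⟩
  rw [this]
  exact MeasurableSpace.measurableSet_generateFrom
    (isOpen_iUnion fun c => hU.preimage ((continuous_linearCombination c).comp hv))

end Analytic

/-! ### Rational block bases as block sequences, and the residual class. -/

section RatBlocks

variable {𝕜 X : Type*} [RCLike 𝕜] [NormedAddCommGroup X] [NormedSpace 𝕜 X]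

instance (e : ℕ → X) : DiscreteTopology (RatBlock 𝕜 e) := ⟨rfl⟩

theorem RatBlock.val_injective (e : ℕ → X) :
    Function.Injective (RatBlock.val : RatBlock 𝕜 e → X) := by
  rintro ⟨a, _⟩ ⟨b, _⟩ h
  cases h
  rfl

instance (e : ℕ → X) : Countable (RatBlock 𝕜 e) := by
  let f : ℚ × ℚ → 𝕜 := fun z => (z.1 : 𝕜) + (z.2 : 𝕜) * RCLike.I
  have hf : f 0 = 0 := by simp [f]
  have hc : (range fun d : ℕ →₀ ℚ × ℚ =>
      ((‖Finsupp.linearCombination 𝕜 e (d.mapRange f hf)‖⁻¹ : ℝ) : 𝕜) •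
        Finsupp.linearCombination 𝕜 e (d.mapRange f hf)).Countable := countable_range _
  have hsub : range (RatBlock.val : RatBlock 𝕜 e → X) ⊆ range fun d : ℕ →₀ ℚ × ℚ =>
      ((‖Finsupp.linearCombination 𝕜 e (d.mapRange f hf)‖⁻¹ : ℝ) : 𝕜) •
        Finsupp.linearCombination 𝕜 e (d.mapRange f hf) := by
    rintro _ ⟨b, rfl⟩
    obtain ⟨c, hc, -, hv⟩ := b.rational
    choose q r hqr using hc
    classical
    let d : ℕ →₀ ℚ × ℚ := Finsupp.onFinset c.support
      (fun i => if c i = 0 then 0 else (q i, r i)) (by intro i hi; simp at hi ⊢; tauto)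
    have hd : d.mapRange f hf = c := by
      ext i
      by_cases hi : c i = 0
      · simp [d, hi, hf]
      · simpa [d, hi, f] using (hqr i).symm
    exact ⟨d, by simp only [hd, hv]⟩
  have := (hc.mono hsub).to_subtype
  exact ((Equiv.ofInjective _ (RatBlock.val_injective e)).injective).countable

/-- Elements of **Q** have supports `[lo q, hi q]` with respect to a sequence that has biorthogonal
functionals. -/
theorem exists_lo_hi {y : ℕ → X} {ψ : ℕ → X →L[𝕜] 𝕜}
    (hψ : ∀ i j, ψ i (y j) = if i = j then 1 else 0) :
    ∃ lo hi : RatBlock 𝕜 y → ℕ, (∀ q, lo q ≤ hi q) ∧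
      (∀ q, q.val ∈ Submodule.span 𝕜 (y '' Icc (lo q) (hi q))) ∧
      ∀ q a b, q.val ∈ Submodule.span 𝕜 (y '' Ico a b) → a ≤ lo q ∧ hi q < b := by
  -- The interval `[lo q, hi q]` is the hull of the support of the coefficients; the functionals `ψ
  -- i` detect this support from the vector alone, which gives its minimality.
  choose c hc hc0 hval using fun q : RatBlock 𝕜 y => q.rational
  have hne : ∀ q, (c q).support.Nonempty := by
    intro q
    rw [Finsupp.support_nonempty_iff]
    rintro h
    exact hc0 q (by simp [h])
  have hψq : ∀ q, ∀ i ∈ (c q).support, ψ i q.val ≠ 0 := by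
    intro q i hi
    have h1 : ψ i (Finsupp.linearCombination 𝕜 y (c q)) = c q i := by
      simp +contextual [Finsupp.linearCombination_apply, Finsupp.sum, hψ]
    rw [hval, map_smul, h1, smul_eq_mul]
    refine mul_ne_zero ?_ (Finsupp.mem_support_iff.1 hi)
    exact_mod_cast inv_ne_zero (norm_ne_zero_iff.2 (hc0 q))
  have hψS : ∀ (S : Set ℕ) (v : X), v ∈ Submodule.span 𝕜 (y '' S) → ∀ i, ψ i v ≠ 0 → i ∈ S := by
    intro S v hv i hi
    by_contra hiS
    refine hi ((Submodule.span_le.2 ?_ : Submodule.span 𝕜 (y '' S) ≤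
      LinearMap.ker (ψ i).toLinearMap) hv)
    rintro _ ⟨j, hj, rfl⟩
    have : i ≠ j := fun h => hiS (h ▸ hj)
    simp [hψ, this]
  refine ⟨fun q => (c q).support.min' (hne q), fun q => (c q).support.max' (hne q),
    fun q => Finset.min'_le_max' _ _, fun q => ?_, fun q a b hq => ?_⟩
  · rw [hval]
    refine Submodule.smul_mem _ _ ?_
    rw [Finsupp.linearCombination_apply, Finsupp.sum]
    refine Submodule.sum_mem _ fun i hi => Submodule.smul_mem _ _ (Submodule.subset_span ?_)
    exact ⟨i, ⟨Finset.min'_le _ _ hi, Finset.le_max' _ _ hi⟩, rfl⟩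
  · have h1 := hψS _ _ hq _ (hψq q _ (Finset.min'_mem _ (hne q)))
    have h2 := hψS _ _ hq _ (hψq q _ (Finset.max'_mem _ (hne q)))
    exact ⟨h1.1, h2.2⟩

theorem RatBlock.val_ne_zero {y : ℕ → X} (q : RatBlock 𝕜 y) : q.val ≠ 0 := by
  obtain ⟨c, -, h0, h⟩ := q.rational
  rw [h]
  refine smul_ne_zero ?_ h0
  exact_mod_cast inv_ne_zero (norm_ne_zero_iff.2 h0)

theorem isRationalScalar_zero : IsRationalScalar (0 : 𝕜) := ⟨0, 0, by simp⟩

theorem isRationalScalar_one : IsRationalScalar (1 : 𝕜) := ⟨1, 0, by simp⟩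

theorem exists_ratBlock {y : ℕ → X} (hy : ∀ n, y n ≠ 0) (n : ℕ) :
    ∃ q : RatBlock 𝕜 y, q.val ∈ Submodule.span 𝕜 (y '' Ico n (n + 1)) := by
  classical
  refine ⟨⟨_, Finsupp.single n 1, fun i => ?_, ?_, rfl⟩, ?_⟩
  · rw [Finsupp.single_apply]
    split_ifs
    · exact isRationalScalar_one
    · exact isRationalScalar_zero
  · simpa using hy n
  · refine Submodule.smul_mem _ _ ?_
    simpa using Submodule.subset_span (s := y '' Ico n (n + 1)) ⟨n, ⟨le_rfl, by omega⟩, rfl⟩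

/-- This transfers the combinatorics of `lo` and `hi` to `bb_d`. The left ends of the supports serve
as dividing indices. -/
theorem isBlockBasis_iff_isBlockSeq {y : ℕ → X} {lo hi : RatBlock 𝕜 y → ℕ}
    (hlh : ∀ q, lo q ≤ hi q) (hspan : ∀ q, q.val ∈ Submodule.span 𝕜 (y '' Icc (lo q) (hi q)))
    (hmin : ∀ q a b, q.val ∈ Submodule.span 𝕜 (y '' Ico a b) → a ≤ lo q ∧ hi q < b)
    (x : ℕ → RatBlock 𝕜 y) :
    IsBlockBasis 𝕜 y (fun n => (x n).val) ↔ IsBlockSeq lo hi x := by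
  constructor
  · rintro ⟨-, p, hp, h⟩ n
    exact (hmin _ _ _ (h n)).2.trans_le (hmin _ _ _ (h (n + 1))).1
  · intro h
    refine ⟨fun n => (x n).val_ne_zero, fun n => lo (x n),
      strictMono_nat_of_lt_succ fun n => (hlh _).trans_lt (h n), fun n => ?_⟩
    refine Submodule.span_mono (image_mono ?_) (hspan (x n))
    exact fun i hi => ⟨hi.1, hi.2.trans_lt (h n)⟩

theorem continuous_val {y : ℕ → X} : Continuous fun (x : BBd 𝕜 y) (n : ℕ) => (x.1 n).val :=
  continuous_pi fun n => (continuous_of_discreteTopology (f := RatBlock.val)).comp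
    ((continuous_apply n).comp continuous_subtype_val)

theorem secondCountableTopology_of_basis (e : UnconditionalSchauderBasis ℕ 𝕜 X) :
    SecondCountableTopology X := by
  have h : closure (Submodule.span 𝕜 (range e) : Set X) = univ := by
    rw [eq_univ_iff_forall]
    intro x
    refine mem_closure_of_tendsto (e.tendsto_proj x) (Filter.Eventually.of_forall fun A => ?_)
    rw [GeneralSchauderBasis.proj_apply]
    exact Submodule.sum_mem _ fun i _ =>
      Submodule.smul_mem _ _ (Submodule.subset_span (mem_range_self i))
  have hs : TopologicalSpace.IsSeparable (univ : Set X) := by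
    rw [← h]
    exact ((countable_range e).isSeparable.span (R := 𝕜)).closure
  have := TopologicalSpace.isSeparable_univ_iff.1 hs
  exact UniformSpace.secondCountable_of_separable X

/-- If the space is not ergodic, each of its block-subspaces has a residual class. -/
theorem exists_inResidualClass [CompleteSpace X] (e : UnconditionalSchauderBasis ℕ 𝕜 X)
    (hX : ¬ IsErgodicSpace 𝕜 X) {y : ℕ → X} (hy : IsBlockBasis 𝕜 e y) :
    ∃ a : BBd 𝕜 y, InResidualClass a := by
  have := secondCountableTopology_of_basis e
  obtain ⟨ψ, hψ⟩ := hy.exists_biorthogonal e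
  obtain ⟨lo, hi, hlh, hspan, hmin⟩ := exists_lo_hi hψ
  have hp := isBlockBasis_iff_isBlockSeq hlh hspan hmin
  have hex : ∀ n, ∃ q, n ≤ lo q := fun n => by
    obtain ⟨q, hq⟩ := exists_ratBlock (𝕜 := 𝕜) hy.1 n
    exact ⟨q, (hmin q _ _ hq).1⟩
  have hpol : PolishSpace (BBd 𝕜 y) := polishSpace_blockSeq hp
  have hEq : Equivalence fun a b : BBd 𝕜 y => Nonempty (a.space ≃L[𝕜] b.space) :=
    ⟨fun a => ⟨.refl 𝕜 _⟩, fun ⟨T⟩ => ⟨T.symm⟩, fun ⟨S⟩ ⟨T⟩ => ⟨S.trans T⟩⟩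
  have htail : ∀ a b : BBd 𝕜 y, (∃ L, ∀ n, L ≤ n → a.1 n = b.1 n) →
      Nonempty (a.space ≃L[𝕜] b.space) := fun a b ⟨L, hL⟩ =>
    nonempty_equiv_of_eventually_eq e (hy.trans a.2) (hy.trans b.2)
      fun n hn => congrArg RatBlock.val (hL n hn)
  have hA : MeasureTheory.AnalyticSet
      {z : BBd 𝕜 y × BBd 𝕜 y | Nonempty (z.1.space ≃L[𝕜] z.2.space)} :=
    analyticSet_nonempty_equiv (𝕜 := 𝕜) (E := fun a b : BBd 𝕜 y => Nonempty (a.space ≃L[𝕜] b.space))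
      (continuous_val (𝕜 := 𝕜) (y := y)) fun a b => Iff.rfl
  rcases exists_reduction_or_residual hlh hex hp hEq htail hA with ⟨f, hf, hfE⟩ | h
  · refine absurd ⟨fun α => closedSpanClosed 𝕜 fun n => ((f α).1 n).val, ?_, ?_⟩ hX
    · exact measurable_closedSpanClosed ((continuous_val (𝕜 := 𝕜) (y := y)).comp hf)
    · exact hfE
  · exact h

end RatBlocks

/-! ### Rational approximation and absorption of block-subspaces. -/

section Absorption

variable {𝕜 X : Type*} [RCLike 𝕜] [NormedAddCommGroup X] [NormedSpace 𝕜 X]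

theorem exists_isRationalScalar_norm_sub_lt (z : 𝕜) {δ : ℝ} (hδ : 0 < δ) :
    ∃ c : 𝕜, IsRationalScalar c ∧ ‖c - z‖ < δ := by
  obtain ⟨q, hq⟩ := exists_rat_near (RCLike.re z) (half_pos hδ)
  obtain ⟨r, hr⟩ := exists_rat_near (RCLike.im z) (half_pos hδ)
  refine ⟨_, ⟨q, r, rfl⟩, ?_⟩
  have h : (q : 𝕜) + (r : 𝕜) * RCLike.I - z =
      (((q : ℝ) - RCLike.re z : ℝ) : 𝕜) + (((r : ℝ) - RCLike.im z : ℝ) : 𝕜) * RCLike.I := by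
    conv_lhs => rw [← RCLike.re_add_im z]
    push_cast
    ring
  rw [h]
  have hI : ‖(RCLike.I : 𝕜)‖ ≤ 1 := by
    rw [RCLike.norm_I]
    split_ifs <;> norm_num
  refine (norm_add_le _ _).trans_lt ?_
  rw [norm_mul, RCLike.norm_ofReal, RCLike.norm_ofReal]
  rw [abs_sub_comm] at hq hr
  nlinarith [abs_nonneg ((r : ℝ) - RCLike.im z), norm_nonneg (RCLike.I : 𝕜)]

theorem exists_rational_combination {y : ℕ → X} {S : Set ℕ} {v : X}
    (hv : v ∈ Submodule.span 𝕜 (y '' S)) {ε : ℝ} (hε : 0 < ε) :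
    ∃ c : ℕ →₀ 𝕜, (∀ i, IsRationalScalar (c i)) ∧
      Finsupp.linearCombination 𝕜 y c ∈ Submodule.span 𝕜 (y '' S) ∧
      ‖Finsupp.linearCombination 𝕜 y c - v‖ < ε := by
  classical
  obtain ⟨d, hd, rfl⟩ := (Finsupp.mem_span_image_iff_linearCombination 𝕜).1 hv
  -- The error is shared among the terms of the support. Adding `1` to the cardinality makes the
  -- total strictly less than `ε`, and adding `1` to the norm allows `y i = 0`.
  have hδ : ∀ i, 0 < ε / ((d.support.card + 1) * (‖y i‖ + 1)) := fun i => by positivity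
  choose g hg hgd using fun i => exists_isRationalScalar_norm_sub_lt (d i) (hδ i)
  let c : ℕ →₀ 𝕜 := Finsupp.onFinset d.support (fun i => if i ∈ d.support then g i else 0)
    fun i hi => by by_contra h; simp [h] at hi
  have hci : ∀ i ∈ d.support, c i = g i := fun i hi => by
    show (if i ∈ d.support then g i else 0) = g i
    rw [if_pos hi]
  have hcs : c.support ⊆ d.support := Finsupp.support_onFinset_subset
  refine ⟨c, fun i => ?_, ?_, ?_⟩
  · by_cases hi : i ∈ d.support
    · rw [hci i hi]; exact hg i
    · rw [Finsupp.notMem_support_iff.1 fun h => hi (hcs h)]; exact isRationalScalar_zero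
  · refine (Finsupp.mem_span_image_iff_linearCombination 𝕜).2 ⟨c, ?_, rfl⟩
    exact Subset.trans (by exact_mod_cast hcs) hd
  · have h1 : Finsupp.linearCombination 𝕜 y c - Finsupp.linearCombination 𝕜 y d =
        ∑ i ∈ d.support, (g i - d i) • y i := by
      rw [Finsupp.linearCombination_apply, Finsupp.linearCombination_apply, Finsupp.sum, Finsupp.sum,
        Finset.sum_subset hcs (by intro i _ hi; simp [Finsupp.notMem_support_iff.1 hi]),
        ← Finset.sum_sub_distrib]
      exact Finset.sum_congr rfl fun i hi => by rw [hci i hi, sub_smul]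
    rw [h1]
    have h2 : ∀ i ∈ d.support, ‖(g i - d i) • y i‖ ≤ ε / (d.support.card + 1) := by
      intro i _
      rw [norm_smul]
      calc ‖g i - d i‖ * ‖y i‖ ≤ ε / ((d.support.card + 1) * (‖y i‖ + 1)) * (‖y i‖ + 1) := by
            have := (hgd i).le
            gcongr
            linarith
        _ = ε / (d.support.card + 1) := by
            field_simp
    refine (norm_sum_le_of_le _ h2).trans_lt ?_
    rw [Finset.sum_const, nsmul_eq_mul, mul_div_assoc', div_lt_iff₀ (by positivity)]
    nlinarith

theorem closedSpan_smul {t : ℕ → 𝕜} (ht : ∀ n, t n ≠ 0) (v : ℕ → X) :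
    closedSpan 𝕜 (fun n => t n • v n) = closedSpan 𝕜 v := by
  refine le_antisymm (cspan_le (isClosed_cspan _) ?_) (cspan_le (isClosed_cspan _) ?_)
  · rintro _ ⟨n, rfl⟩
    exact Submodule.smul_mem _ _ (subset_cspan _ (mem_range_self n))
  · rintro _ ⟨n, rfl⟩
    have := Submodule.smul_mem (cspan 𝕜 (range fun n => t n • v n)) (t n)⁻¹
      (subset_cspan _ (mem_range_self n))
    rwa [smul_smul, inv_mul_cancel₀ (ht n), one_smul] at this

theorem nonempty_equiv_of_automorphism {v w : ℕ → X} (S : X ≃L[𝕜] X) (h : ∀ n, S (v n) = w n) :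
    Nonempty (closedSpan 𝕜 v ≃L[𝕜] closedSpan 𝕜 w) := by
  refine nonempty_cspan_equiv (S : X →L[𝕜] X) (S.symm : X →L[𝕜] X) ?_ ?_ ?_ ?_
  · rintro _ ⟨n, rfl⟩
    exact subset_cspan _ ⟨n, (h n).symm⟩
  · rintro _ ⟨n, rfl⟩
    exact subset_cspan _ ⟨n, by simp [← h n]⟩
  · simp
  · simp

/-- Every block-subspace is isomorphic to one spanned by an element of `bb_d`. -/
theorem exists_bbd_equiv [CompleteSpace X] (e : UnconditionalSchauderBasis ℕ 𝕜 X) {y w : ℕ → X}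
    (hy : IsBlockBasis 𝕜 e y) (hw : IsBlockBasis 𝕜 y w) :
    ∃ x : BBd 𝕜 y, Nonempty (closedSpan 𝕜 w ≃L[𝕜] x.space) := by
  obtain ⟨ψ, hψ⟩ := (hy.trans hw).exists_biorthogonal e
  obtain ⟨-, p, hp, hpw⟩ := hw
  -- These tolerances are the ones required by `exists_automorphism`.
  have hpos : ∀ n, 0 < (1 / 4 : ℝ) * (1 / 2) ^ n / (‖ψ n‖ + 1) := fun n => by positivity
  choose c hc hcs hcw using fun n => exists_rational_combination (hpw n) (hpos n)
  have hle : ∀ n, ‖ψ n‖ * ‖Finsupp.linearCombination 𝕜 y (c n) - w n‖ ≤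
      (1 / 4) * (1 / 2) ^ n := by
    intro n
    have := (hcw n).le
    rw [le_div_iff₀ (by positivity)] at this
    nlinarith [norm_nonneg (Finsupp.linearCombination 𝕜 y (c n) - w n)]
  obtain ⟨S, hS⟩ := exists_automorphism hψ hle
  have hw0 : ∀ n, w n ≠ 0 := fun n h => by
    have := hψ n n
    simp [h] at this
  have h0 : ∀ n, Finsupp.linearCombination 𝕜 y (c n) ≠ 0 := fun n => by
    rw [← hS n]
    simpa using hw0 n
  let x : ℕ → RatBlock 𝕜 y := fun n => ⟨_, c n, hc n, h0 n, rfl⟩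
  refine ⟨⟨x, fun n => (x n).val_ne_zero, p, hp, fun n => Submodule.smul_mem _ _ (hcs n)⟩, ?_⟩
  have h1 := nonempty_equiv_of_automorphism S hS
  rw [← closedSpan_smul (t := fun n =>
    ((‖Finsupp.linearCombination 𝕜 y (c n)‖⁻¹ : ℝ) : 𝕜)) (fun n => by
      exact_mod_cast inv_ne_zero (norm_ne_zero_iff.2 (h0 n)))
      fun n => Finsupp.linearCombination 𝕜 y (c n)] at h1
  exact h1

/-- A generic block-subspace of `[y]` absorbs every block-subspace of `[y]`. -/
theorem InResidualClass.nonempty_equiv_prod [CompleteSpace X]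
    (e : UnconditionalSchauderBasis ℕ 𝕜 X) {y w : ℕ → X} (hy : IsBlockBasis 𝕜 e y)
    (hw : IsBlockBasis 𝕜 y w) {a : BBd 𝕜 y} (ha : InResidualClass a) :
    Nonempty (a.space ≃L[𝕜] (a.space × closedSpan 𝕜 w)) := by
  obtain ⟨ψ, hψ⟩ := hy.exists_biorthogonal e
  obtain ⟨lo, hi, hlh, hspan, hmin⟩ := exists_lo_hi hψ
  have hp := isBlockBasis_iff_isBlockSeq hlh hspan hmin
  have hex : ∀ n, ∃ q, n ≤ lo q := fun n => by
    obtain ⟨q, hq⟩ := exists_ratBlock (𝕜 := 𝕜) hy.1 n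
    exact ⟨q, (hmin q _ _ hq).1⟩
  obtain ⟨v, ⟨Tv⟩⟩ := exists_bbd_equiv e hy hw
  obtain ⟨J, J', hU, hd, hK⟩ := exists_generic_interleaved hlh hex hp ha ((hp _).1 v.2)
  let V : ℕ → X := fun n => (v.1 n).val
  have hP : ∀ (P : X →L[𝕜] X) (S : Set ℕ) (q : RatBlock 𝕜 y), Icc (lo q) (hi q) ⊆ S →
      (∀ i ∈ S, P (y i) = y i) → P q.val = q.val := by
    intro P S q hq h
    refine (Submodule.span_le.2 ?_ : Submodule.span 𝕜 (y '' Icc (lo q) (hi q)) ≤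
      LinearMap.eqLocus P.toLinearMap LinearMap.id) (hspan q)
    rintro _ ⟨j, hj, rfl⟩
    exact h j (hq hj)
  have hP' : ∀ (P : X →L[𝕜] X) (S : Set ℕ) (q : RatBlock 𝕜 y), Disjoint (Icc (lo q) (hi q)) S →
      (∀ i ∉ S, P (y i) = 0) → P q.val = 0 := by
    intro P S q hq h
    refine (Submodule.span_le.2 ?_ : Submodule.span 𝕜 (y '' Icc (lo q) (hi q)) ≤
      LinearMap.ker P.toLinearMap) (hspan q)
    rintro _ ⟨j, hj, rfl⟩
    exact h j (disjoint_left.1 hq hj)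
  have key : ∀ K ∈ ({J, J'} : Set (Set ℕ)),
      Nonempty (a.space ≃L[𝕜] (a.space × cspan 𝕜 (V '' K))) := by
    intro K hKm
    obtain ⟨u, ⟨Tu⟩, x, ⟨Tx⟩, hr, hap⟩ := hK K hKm
    -- Projecting onto the supports of `u` fixes `u` and kills the terms of `V` with index in `K`,
    -- whose supports are disjoint from those of `u`.
    obtain ⟨P, hPS, hPS'⟩ := hy.exists_projection e (⋃ i, Icc (lo (u.1 i)) (hi (u.1 i)))
    have hr' : range (fun n => (x.1 n).val) = range (fun n => (u.1 n).val) ∪ V '' K := by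
      have := congrArg (image RatBlock.val) hr
      rw [image_union, ← range_comp, ← range_comp, image_image] at this
      exact this
    obtain ⟨T⟩ := nonempty_cspan_equiv_prod (𝕜 := 𝕜) (A := range fun n => (u.1 n).val)
      (B := V '' K) P (by
        rintro _ ⟨n, rfl⟩
        exact hP P _ (u.1 n) (subset_iUnion (fun i => Icc (lo (u.1 i)) (hi (u.1 i))) n) hPS) (by
        rintro _ ⟨j, hj, rfl⟩
        refine hP' P _ (v.1 j) ?_ hPS'
        rw [disjoint_iUnion_right]
        intro i
        rw [disjoint_left]
        rintro k ⟨h1, h2⟩ ⟨h3, h4⟩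
        rcases hap i j hj with h | h <;> omega)
    rw [← hr'] at T
    have T' : BBd.space x ≃L[𝕜] (BBd.space u × cspan 𝕜 (V '' K)) := T
    exact ⟨(Tx.trans T').trans (Tu.symm.prodCongr (.refl 𝕜 _))⟩
  obtain ⟨T1⟩ := key J (by simp)
  obtain ⟨T2⟩ := key J' (by simp)
  obtain ⟨P, hPJ, hPJ'⟩ := (hy.trans v.2).exists_projection e J
  have hV : range V = V '' J ∪ V '' J' := by rw [← image_union, hU, image_univ]
  obtain ⟨T3⟩ := nonempty_cspan_equiv_prod (𝕜 := 𝕜) (A := V '' J) (B := V '' J') P (by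
      rintro _ ⟨j, hj, rfl⟩
      exact hPJ j hj) (by
      rintro _ ⟨j, hj, rfl⟩
      exact hPJ' j (disjoint_right.1 hd hj))
  rw [← hV] at T3
  have T3' : v.space ≃L[𝕜] (cspan 𝕜 (V '' J) × cspan 𝕜 (V '' J')) := T3
  -- With `A = a.space`: `A ≃ A ⊕ [V_J'] ≃ (A ⊕ [V_J]) ⊕ [V_J'] ≃ A ⊕ [V] ≃ A ⊕ [w]`.
  exact ⟨((T2.trans (T1.prodCongr (.refl 𝕜 _))).trans (.prodAssoc 𝕜 _ _ _)).trans
    ((ContinuousLinearEquiv.refl 𝕜 _).prodCongr (Tv.trans T3').symm)⟩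

end Absorption

/-! ### Gliding hump and uniqueness under hereditary block-minimality. -/

section Embedding

variable {𝕜 X : Type*} [RCLike 𝕜] [NormedAddCommGroup X] [NormedSpace 𝕜 X]

/-- Dimension count: `ρ` linear conditions on a space of coefficients of dimension `ρ + 1`. -/
theorem exists_supported_coord_eq_zero {L : SummationFilter ℕ} (e : GeneralSchauderBasis ℕ 𝕜 X L)
    (τ : (ℕ →₀ 𝕜) →ₗ[𝕜] X) (m ρ : ℕ) :
    ∃ d ∈ Finsupp.supported 𝕜 𝕜 (Ico m (m + (ρ + 1))), d ≠ 0 ∧ ∀ k < ρ, e.coord k (τ d) = 0 := by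
  let V := Finsupp.supported 𝕜 𝕜 (Ico m (m + (ρ + 1)))
  let E : V ≃ₗ[𝕜] (Ico m (m + (ρ + 1)) →₀ 𝕜) := Finsupp.supportedEquivFinsupp _
  have hfin : FiniteDimensional 𝕜 V := E.symm.finiteDimensional
  let Φ : V →ₗ[𝕜] (Fin ρ → 𝕜) :=
    LinearMap.pi fun k => (e.coord k).toLinearMap ∘ₗ τ ∘ₗ V.subtype
  have hlt : Module.finrank 𝕜 (Fin ρ → 𝕜) < Module.finrank 𝕜 V := by
    rw [E.finrank_eq]
    simp
  have hker : LinearMap.ker Φ ≠ ⊥ :=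
    LinearMap.ker_ne_bot_of_finrank_lt (K := 𝕜) (V := V) (V₂ := Fin ρ → 𝕜) hlt
  obtain ⟨d, hd, hd0⟩ := (Submodule.ne_bot_iff _).1 hker
  refine ⟨d, d.2, fun h => hd0 (Subtype.ext h), fun k hk => ?_⟩
  exact congrFun (LinearMap.mem_ker.1 hd) ⟨k, hk⟩

theorem proj_block {e : UnconditionalSchauderBasis ℕ 𝕜 X} {x : ℕ → X} {r : ℕ → ℕ}
    (hr : StrictMono r) (hx : ∀ n, x n ∈ Submodule.span 𝕜 (e '' Ico (r n) (r (n + 1))))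
    (N i : ℕ) : e.proj (Finset.range (r N)) (x i) = if i < N then x i else 0 := by
  split_ifs with h
  · refine (Submodule.span_le.2 ?_ : Submodule.span 𝕜 (e '' Ico (r i) (r (i + 1))) ≤
      LinearMap.eqLocus (e.proj (Finset.range (r N))).toLinearMap LinearMap.id) (hx i)
    rintro _ ⟨j, hj, rfl⟩
    have h1 : r (i + 1) ≤ r N := hr.monotone h
    show e.proj _ (e j) = e j
    rw [e.proj_apply_basis_mem, if_pos (Finset.mem_range.2 (hj.2.trans_le h1))]
  · refine (Submodule.span_le.2 ?_ : Submodule.span 𝕜 (e '' Ico (r i) (r (i + 1))) ≤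
      LinearMap.ker (e.proj (Finset.range (r N))).toLinearMap) (hx i)
    rintro _ ⟨j, hj, rfl⟩
    have h1 : r N ≤ r i := hr.monotone (not_lt.1 h)
    show e.proj _ (e j) = 0
    rw [e.proj_apply_basis_mem, if_neg]
    simpa using h1.trans hj.1

theorem coord_proj {L : SummationFilter ℕ} (e : GeneralSchauderBasis ℕ 𝕜 X L) (n k : ℕ) (v : X) :
    e.coord k (e.proj (Finset.range n) v) = if k < n then e.coord k v else 0 := by
  rw [e.proj_apply]
  simp [e.ortho, Pi.single_apply]

/-- One step of the gliding hump argument. -/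
theorem exists_gliding_step (e : UnconditionalSchauderBasis ℕ 𝕜 X) {x : ℕ → X} {r : ℕ → ℕ}
    (hr : StrictMono r) (hx : ∀ n, x n ∈ Submodule.span 𝕜 (e '' Ico (r n) (r (n + 1))))
    {τ : (ℕ →₀ 𝕜) →ₗ[𝕜] X} (hτ : ∀ c, τ c ∈ closedSpan 𝕜 x) (hτ0 : ∀ c, c ≠ 0 → τ c ≠ 0)
    {ε : ℝ} (hε : 0 < ε) (m N : ℕ) :
    ∃ (m' N' : ℕ) (d : ℕ →₀ 𝕜) (w : X) (ψ : X →L[𝕜] 𝕜), m < m' ∧ N < N' ∧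
      d ∈ Finsupp.supported 𝕜 𝕜 (Ico m m') ∧ d ≠ 0 ∧
      w ∈ Submodule.span 𝕜 (x '' Ico N N') ∧ ψ w = 1 ∧
      (∀ i, i ∉ Ico N N' → ψ (x i) = 0) ∧ ‖ψ‖ * ‖τ d - w‖ ≤ ε := by
  obtain ⟨d, hd, hd0, hdk⟩ := exists_supported_coord_eq_zero e τ m (r N)
  obtain ⟨k, hk⟩ := exists_coord_ne_zero e (hτ0 d hd0)
  have hkN : r N ≤ k := not_lt.1 fun h => hk (hdk k h)
  -- Normalized at `τ d`, this functional also equals `1` at every truncation of `τ d` beyond `k`.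
  -- Its norm is thus known before `N'` is chosen.
  let ψ : X →L[𝕜] 𝕜 := (e.coord k (τ d))⁻¹ • e.coord k
  have hlim : Filter.Tendsto (fun n => e.proj (Finset.range (r n)) (τ d)) Filter.atTop
      (𝓝 (τ d)) :=
    (e.tendsto_proj (τ d)).comp
      (Filter.tendsto_finset_range.comp hr.tendsto_atTop)
  obtain ⟨N', hN', hNN', hkN'⟩ : ∃ N', ‖τ d - e.proj (Finset.range (r N')) (τ d)‖ <
      ε / (‖ψ‖ + 1) ∧ N < N' ∧ k < r N' := by
    have h1 := Metric.tendsto_nhds.1 hlim (ε / (‖ψ‖ + 1)) (by positivity)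
    obtain ⟨n, hn, h2, h3⟩ := (h1.and ((Filter.eventually_gt_atTop N).and
      (hr.tendsto_atTop.eventually_gt_atTop k))).exists
    exact ⟨n, by rwa [← dist_eq_norm, dist_comm], h2, h3⟩
  have hπN : e.proj (Finset.range (r N)) (τ d) = 0 := by
    rw [e.proj_apply]
    exact Finset.sum_eq_zero fun i hi => by rw [hdk i (Finset.mem_range.1 hi), zero_smul]
  have hrN : r N ≤ r N' := hr.monotone hNN'.le
  refine ⟨m + (r N + 1), N', d, e.proj (Finset.range (r N')) (τ d), ψ, by omega, hNN', hd, hd0,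
    ?_, ?_, ?_, ?_⟩
  -- `R` cuts `[x]` down to the blocks with index in `[N, N')`. Since `τ d` has no coordinates below
  -- `r N`, its image under `R` is its truncation at `r N'`.
  · let R : X →L[𝕜] X := e.proj (Finset.range (r N')) - e.proj (Finset.range (r N))
    have h1 : ∀ v ∈ range x, R v ∈ cspan 𝕜 (x '' Ico N N') := by
      rintro _ ⟨i, rfl⟩
      show e.proj (Finset.range (r N')) (x i) - e.proj (Finset.range (r N)) (x i) ∈ _
      rw [proj_block hr hx, proj_block hr hx]
      by_cases h1 : i < N
      · rw [if_pos h1, if_pos (h1.trans hNN'), sub_self]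
        exact zero_mem _
      · by_cases h2 : i < N'
        · rw [if_pos h2, if_neg h1, sub_zero]
          exact subset_cspan _ ⟨i, ⟨not_lt.1 h1, h2⟩, rfl⟩
        · rw [if_neg h2, if_neg h1, sub_zero]
          exact zero_mem _
    have h2 := map_mem_cspan h1 (hτ d)
    rw [cspan_eq_span_of_finite ((finite_Ico N N').image x)] at h2
    have h3 : R (τ d) = e.proj (Finset.range (r N')) (τ d) := by
      show e.proj (Finset.range (r N')) (τ d) - e.proj (Finset.range (r N)) (τ d) = _
      rw [hπN, sub_zero]
    rwa [h3] at h2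
  · show (e.coord k (τ d))⁻¹ * e.coord k (e.proj (Finset.range (r N')) (τ d)) = 1
    rw [coord_proj, if_pos hkN', inv_mul_cancel₀ hk]
  · intro i hi
    show (e.coord k (τ d))⁻¹ * e.coord k (x i) = 0
    rw [coord_eq_zero e ?_ (hx i), mul_zero]
    intro hki
    refine hi ⟨?_, ?_⟩
    · by_contra h
      have := hr.monotone (show i + 1 ≤ N by omega)
      have := hki.2
      omega
    · by_contra h
      have := hr.monotone (show N' ≤ i by omega)
      have := hki.1
      omega
  · rw [lt_div_iff₀ (by positivity)] at hN'
    nlinarith [norm_nonneg (τ d - e.proj (Finset.range (r N')) (τ d)), norm_nonneg ψ]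

/-- In a hereditarily block-minimal space every block-subspace embeds as a block-subspace into
every other one. -/
theorem HereditarilyBlockMinimal.exists_equiv_block [CompleteSpace X]
    (e : UnconditionalSchauderBasis ℕ 𝕜 X) (he : HereditarilyBlockMinimal 𝕜 e) {y b : ℕ → X}
    (hy : IsBlockBasis 𝕜 e y) (hb : IsBlockBasis 𝕜 e b) :
    ∃ z, IsBlockBasis 𝕜 y z ∧ Nonempty (closedSpan 𝕜 z ≃L[𝕜] closedSpan 𝕜 b) := by
  -- Block-minimality of `X` gives a copy of `X`, hence of `[b]`, inside `[y]`. The images `t n` of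
  -- the `b n` need not be blocks, which the gliding hump repairs along the combinations `D j`.
  obtain ⟨x, hx, ⟨T⟩⟩ := he e (IsBlockBasis.refl (basis_ne_zero e)) y hy
  have hbe : ∀ n, b n ∈ closedSpan 𝕜 e := fun n => by
    obtain ⟨-, p, -, hp⟩ := hb
    exact Submodule.le_topologicalClosure _
      (Submodule.span_mono (image_subset_range _ _) (hp n))
  obtain ⟨K, hK⟩ := exists_norm_le_of_equiv T.symm fun n => ⟨b n, hbe n⟩
  let t : ℕ → X := fun n => T.symm ⟨b n, hbe n⟩
  let β := Finsupp.linearCombination 𝕜 b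
  let τ := Finsupp.linearCombination 𝕜 t
  have hK1 : ∀ c, ‖τ c‖ ≤ K * ‖β c‖ := fun c => (hK c).1
  have hK2 : ∀ c, ‖β c‖ ≤ K * ‖τ c‖ := fun c => (hK c).2
  have hτx : ∀ c, τ c ∈ closedSpan 𝕜 x := by
    intro c
    refine (Submodule.span_le.2 ?_ : Submodule.span 𝕜 (range t) ≤ closedSpan 𝕜 x)
      (Finsupp.mem_span_range_iff_exists_finsupp.2 ⟨c, rfl⟩)
    rintro _ ⟨n, rfl⟩
    exact (T.symm ⟨b n, hbe n⟩).2
  obtain ⟨φ, hφ⟩ := hb.exists_biorthogonal e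
  have hβ0 : ∀ c, c ≠ 0 → β c ≠ 0 := fun c hc h =>
    hc (linearIndependent_iff.1 (linearIndependent_of_biorthogonal hφ) c h)
  have hτ0 : ∀ c, c ≠ 0 → τ c ≠ 0 := fun c hc h => by
    have := hK2 c
    rw [h, norm_zero, mul_zero] at this
    exact hβ0 c hc (norm_le_zero_iff.1 this)
  obtain ⟨-, r, hr, hxr⟩ := hy.trans hx
  choose m' N' d w ψ hm hN hd hd0 hw hψw hψx hle using fun (j m N : ℕ) =>
    exists_gliding_step e hr hxr hτx hτ0 (show 0 < (1 / 4 : ℝ) * (1 / 2) ^ j by positivity) m N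
  let Z : ℕ → ℕ × ℕ := fun j => Nat.rec (0, 0) (fun j z => (m' j z.1 z.2, N' j z.1 z.2)) j
  let M : ℕ → ℕ := fun j => (Z j).1
  let N : ℕ → ℕ := fun j => (Z j).2
  let D : ℕ → (ℕ →₀ 𝕜) := fun j => d j (M j) (N j)
  let W : ℕ → X := fun j => w j (M j) (N j)
  let Ψ : ℕ → X →L[𝕜] 𝕜 := fun j => ψ j (M j) (N j)
  have hMm : StrictMono M := strictMono_nat_of_lt_succ fun j => hm j (M j) (N j)
  have hNm : StrictMono N := strictMono_nat_of_lt_succ fun j => hN j (M j) (N j)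
  have hW : ∀ j, W j ∈ Submodule.span 𝕜 (x '' Ico (N j) (N (j + 1))) := fun j =>
    hw j (M j) (N j)
  have hD : ∀ j, D j ∈ Finsupp.supported 𝕜 𝕜 (Ico (M j) (M (j + 1))) := fun j =>
    hd j (M j) (N j)
  have hΨ : ∀ i j, Ψ i (W j) = if i = j then 1 else 0 := by
    intro i j
    by_cases hij : i = j
    · subst hij
      rw [if_pos rfl]
      exact hψw i (M i) (N i)
    · rw [if_neg hij]
      refine (Submodule.span_le.2 ?_ : Submodule.span 𝕜 (x '' Ico (N j) (N (j + 1))) ≤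
        LinearMap.ker (Ψ i).toLinearMap) (hW j)
      rintro _ ⟨l, hl, rfl⟩
      refine hψx i (M i) (N i) l fun hli => ?_
      have hli : l ∈ Ico (N i) (N (i + 1)) := hli
      rcases lt_or_gt_of_ne hij with h | h
      · have := hNm.monotone (show i + 1 ≤ j from h)
        have := hl.1
        have := hli.2
        omega
      · have := hNm.monotone (show j + 1 ≤ i from h)
        have := hl.2
        have := hli.1
        omega
  obtain ⟨S, hS⟩ := exists_automorphism (w' := fun j => τ (D j)) hΨ fun j => hle j (M j) (N j)
  have hWb : IsBlockBasis 𝕜 x W := ⟨fun j h => by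
    have := hΨ j j
    simp [h] at this, N, hNm, hW⟩
  have hDb : IsBlockBasis 𝕜 b fun j => β (D j) :=
    ⟨fun j => hβ0 _ (hd0 j (M j) (N j)), M, hMm, fun j =>
      (Finsupp.mem_span_image_iff_linearCombination 𝕜).2 ⟨D j, hD j, rfl⟩⟩
  -- The hump only realizes a block-subspace of `[b]` as blocks of `x`. Block-minimality of `[b]`
  -- finds a copy of `[b]` inside it, and the coefficients `γ n` of that copy are then applied to
  -- `W`.
  obtain ⟨c, ⟨hc0, p, hp, hc⟩, ⟨Tc⟩⟩ := he b hb _ hDb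
  choose γ hγ hγc using fun n => (Finsupp.mem_span_image_iff_linearCombination 𝕜).1 (hc n)
  let g : ℕ → (ℕ →₀ 𝕜) := fun n => Finsupp.linearCombination 𝕜 D (γ n)
  have hβg : ∀ n, β (g n) = c n := fun n => by
    rw [← hγc n]
    exact Finsupp.apply_linearCombination 𝕜 β D (γ n)
  have hτg : ∀ n, S (Finsupp.linearCombination 𝕜 W (γ n)) = τ (g n) := fun n => by
    have h1 := Finsupp.apply_linearCombination 𝕜 S.toLinearEquiv.toLinearMap W (γ n)
    have h2 := Finsupp.apply_linearCombination 𝕜 τ D (γ n)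
    refine (h1.trans ?_).trans h2.symm
    congr 2
    funext j
    exact hS j
  have hlc : ∀ (f : (ℕ →₀ 𝕜) →ₗ[𝕜] X) (l : ℕ →₀ 𝕜),
      Finsupp.linearCombination 𝕜 (fun n => f (g n)) l = f (Finsupp.linearCombination 𝕜 g l) :=
    fun f l => (Finsupp.apply_linearCombination 𝕜 f g l).symm
  obtain ⟨T1⟩ := nonempty_equiv_of_automorphism S hτg
  obtain ⟨T2⟩ := exists_equiv_of_norm_le (𝕜 := 𝕜) (a := fun n => τ (g n)) (x := fun n => β (g n))
    (K := K) (fun l => by rw [hlc, hlc]; exact hK2 _) (fun l => by rw [hlc, hlc]; exact hK1 _)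
  have hcβ : closedSpan 𝕜 (fun n => β (g n)) = closedSpan 𝕜 c := by
    congr 1
    funext n
    exact hβg n
  rw [hcβ] at T2
  refine ⟨fun n => Finsupp.linearCombination 𝕜 W (γ n), (hx.trans hWb).trans ⟨fun n h => ?_, p, hp,
    fun n => (Finsupp.mem_span_image_iff_linearCombination 𝕜).2 ⟨γ n, hγ n, rfl⟩⟩,
    ⟨(T1.trans T2).trans Tc⟩⟩
  have h1 : γ n = 0 := linearIndependent_iff.1 (linearIndependent_of_biorthogonal hΨ) _ h
  refine hc0 n ?_
  rw [← hγc n, h1, map_zero]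

/-- Each space is isomorphic to a block-subspace of the space in which the other is generic, so each
absorbs the other: `A ≃ A ⊕ B ≃ B ⊕ A ≃ B`. -/
theorem nonempty_equiv_of_inResidualClass [CompleteSpace X]
    (e : UnconditionalSchauderBasis ℕ 𝕜 X) (he : HereditarilyBlockMinimal 𝕜 e) {y z : ℕ → X}
    (hy : IsBlockBasis 𝕜 e y) (hz : IsBlockBasis 𝕜 e z) {a : BBd 𝕜 y} {b : BBd 𝕜 z}
    (ha : InResidualClass a) (hb : InResidualClass b) :
    Nonempty (a.space ≃L[𝕜] b.space) := by
  obtain ⟨u, hu, ⟨Tu⟩⟩ := he.exists_equiv_block e hy (hz.trans b.2)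
  obtain ⟨v, hv, ⟨Tv⟩⟩ := he.exists_equiv_block e hz (hy.trans a.2)
  obtain ⟨T1⟩ := ha.nonempty_equiv_prod e hy hu
  obtain ⟨T2⟩ := hb.nonempty_equiv_prod e hz hv
  have Tu' : closedSpan 𝕜 u ≃L[𝕜] b.space := Tu
  have Tv' : closedSpan 𝕜 v ≃L[𝕜] a.space := Tv
  exact ⟨((T1.trans ((ContinuousLinearEquiv.refl 𝕜 _).prodCongr Tu')).trans
    (ContinuousLinearEquiv.prodComm 𝕜 _ _)).trans
    (T2.trans ((ContinuousLinearEquiv.refl 𝕜 _).prodCongr Tv')).symm⟩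

end Embedding

end ErgodicBanach

open ErgodicBanach in
theorem mainTheorem5 {𝕜 X : Type*} [RCLike 𝕜] [NormedAddCommGroup X] [NormedSpace 𝕜 X]
    [CompleteSpace X] (e : UnconditionalSchauderBasis ℕ 𝕜 X) (hX : ¬ IsErgodicSpace 𝕜 X) :
    -- the residual class exists, in `bb_d(X)` (the case `y = e`) and in `bb_d(Y)`, `Y = [y] ≤ X`
    (∀ y : ℕ → X, IsBlockBasis 𝕜 e y → ∃ a : BBd 𝕜 y, InResidualClass a) ∧
    (∀ a : BBd 𝕜 e, InResidualClass a → ∀ y : ℕ → X, IsBlockBasis 𝕜 e y →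
      Nonempty (a.space ≃L[𝕜] (a.space × closedSpan 𝕜 y))) ∧
    (HereditarilyBlockMinimal 𝕜 e →
      ∀ y z : ℕ → X, IsBlockBasis 𝕜 e y → IsBlockBasis 𝕜 e z →
        ∀ (a : BBd 𝕜 y) (b : BBd 𝕜 z), InResidualClass a → InResidualClass b →
          Nonempty (a.space ≃L[𝕜] b.space)) := by
  refine ⟨fun y hy => exists_inResidualClass e hX hy, fun a ha y hy => ?_,
    fun he y z hy hz a b ha hb => nonempty_equiv_of_inResidualClass e he hy hz ha hb⟩
  exact ha.nonempty_equiv_prod e (IsBlockBasis.refl (basis_ne_zero e)) hy
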